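/- Notation. Let $\Lambda=(0,\infty)$ and, for $a\in\mathbb R$, let $w^a(x)=x^a$. Let $(u,v)_{w^a}=\int_0^\infty u\,v\,x^a\,dx$ on $L^2_{w^a}(\Lambda)$. For $m\in\mathbb N_0=\{0,1,2,\dots\}$ let $H^m_{w^a}(\Lambda)$ be the space of real functions $v$ on $\Lambda$ whose weak derivatives $\partial_x^k v$, $0\le k\le m$, all lie in $L^2_{w^a}(\Lambda)$. For $\beta>0$ and $N\in\mathbb N_0$ let $X_N^\beta=\{e^{-\beta x/2}p(x): p \text{ a real polynomial of degree} \le N\}$. For $n\in\mathbb N_0$ and $\alpha\in\mathbb R$ with $\alpha+n>-1$ put $$a_n^{\alpha,\beta}(u,v)=\sum_{\nu=0}^n\binom n\nu\frac{\beta^{2n-2\nu}}{2^{2n-2\nu}}(\partial_x^\nu u,\partial_x^\nu v)_{w^{\alpha+n}},\qquad \|u\|_{n,\alpha,\beta}=a_n^{\alpha,\beta}(u,u)^{1/2},$$ for $u,v\in H^n_{w^{\alpha+n}}(\Lambda)$, and let $\pi_{n,N}^{\alpha,\beta}:H^n_{w^{\alpha+n}}(\Lambda)\to X_N^\beta$ be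 the orthogonal projection given by $a_n^{\alpha,\beta}(u-\pi_{n,N}^{\alpha,\beta}u,v)=0$ for all $v\in X_N^\beta$. Theorem 4.1. Let $r\in\mathbb N_0$ and $\alpha>-r-1$. (i) For all $\beta>0$, $N\in\mathbb N_0$ and $u\in H^r_{w^{\alpha+r}}(\Lambda)$, the projection $\pi_{r,N}^{\alpha,\beta}u$ exists and is unique. For every $s\in\mathbb N_0$ with $-\alpha-1<s\le r$ one has $u\in H^s_{w^{\alpha+s}}(\Lambda)$. If $N>-\alpha-1$, then $\pi_{s,N}^{\alpha,\beta}u=\pi_{r,N}^{\alpha,\beta}u$ for every $s\in\mathbb N_0$ with $s>-\alpha-1$ and $u\in H^s_{w^{\alpha+s}}(\Lambda)$ (in particular for every such $s\le r$). The common value is denoted by $\pi_N^{\alpha,\beta}u$. (ii) There is a constant $c>0$ that depends only on $\alpha$ and $r$ such that, for all $\beta>0$, all $u\in H^r_{w^{\alpha+r}}(\Lambda)$ and all $N,s\in\mathbb N_0$ with $N>-\alpha-1$, $-\alpha-1<s\le r$, and $N\ge1$ or $s=r$, $$\|u-\pi_N^{\alpha,\beta}u\|_{s,\alpha,\beta}\le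 c\,(\beta N)^{\frac{s-r}2}\|u-\pi_N^{\alpha,\beta}u\|_{r,\alpha,\beta}$$ and $$(\beta N)^{\frac{s-r}2}\|u-\pi_N^{\alpha,\beta}u\|_{r,\alpha,\beta}\le c\,(\beta N)^{\frac{s-r}2}\|u\|_{r,\alpha,\beta},$$ where $(\beta N)^0=1$ also for $N=0$. -/

import Mathlib

open MeasureTheory Set
open scoped ContDiff

namespace Laguerre

noncomputable section

/-- `g` is the weak (distributional) derivative of order `k` of `u` on the half line
`(0, ∞)`; both functions are locally integrable there. -/
def IsWeakDeriv (k : ℕ) (u g : ℝ → ℝ) : Prop :=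
  LocallyIntegrableOn u (Ioi 0) volume ∧ LocallyIntegrableOn g (Ioi 0) volume ∧
  ∀ φ : ℝ → ℝ, ContDiff ℝ ∞ φ → HasCompactSupport φ → tsupport φ ⊆ Ioi 0 →
    ∫ x in Ioi 0, u x * iteratedDeriv k φ x = (-1) ^ k * ∫ x in Ioi 0, g x * φ x

open Classical in
/-- The weak derivative of order `k` of `u` on `(0, ∞)`. It is determined almost everywhere
by `u` when it exists; the value is `0` when there is none. -/
def weakDeriv (k : ℕ) (u : ℝ → ℝ) : ℝ → ℝ :=
  if h : ∃ g, IsWeakDeriv k u g then h.choose else 0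

/-- The weighted space `L²_ϖ(0, ∞)`. -/
def MemL2 (ϖ : ℝ → ℝ) (v : ℝ → ℝ) : Prop :=
  AEStronglyMeasurable v (volume.restrict (Ioi 0)) ∧
    IntegrableOn (fun x => v x ^ 2 * ϖ x) (Ioi 0) volume

/-- The inner product `(u, v)_ϖ` of `L²_ϖ(0, ∞)`. -/
def innerL2 (ϖ : ℝ → ℝ) (u v : ℝ → ℝ) : ℝ :=
  ∫ x in Ioi 0, u x * v x * ϖ x

/-- The weighted Sobolev space `H^m_ϖ(0, ∞)`: the weak derivatives of the orders `0, …, m`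
exist and lie in `L²_ϖ(0, ∞)`. -/
def MemH (m : ℕ) (ϖ : ℝ → ℝ) (v : ℝ → ℝ) : Prop :=
  ∀ k ≤ m, ∃ g, IsWeakDeriv k v g ∧ MemL2 ϖ g

/-- The power weight `w^a(x) = x^a`. -/
def powWeight (a : ℝ) : ℝ → ℝ := fun x => x ^ a

/-- The bilinear form
`a_n^{α,β}(u,v) = ∑_{ν ≤ n} C(n,ν) (β/2)^{2n-2ν} (∂^ν u, ∂^ν v)_{w^{α+n}}`. -/
def form (n : ℕ) (α β : ℝ) (u v : ℝ → ℝ) : ℝ :=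
  ∑ ν ∈ Finset.range (n + 1),
    (n.choose ν : ℝ) * (β ^ (2 * n - 2 * ν) / 2 ^ (2 * n - 2 * ν)) *
      innerL2 (powWeight (α + n)) (weakDeriv ν u) (weakDeriv ν v)

/-- The norm `‖u‖_{r,α,β} = a_r^{α,β}(u,u)^{1/2}`. -/
def sobNorm (r : ℕ) (α β : ℝ) (u : ℝ → ℝ) : ℝ :=
  Real.sqrt (form r α β u u)

/-- The space `X_N^β = e^{-βx/2} ℙ_N`. -/
def X (N : ℕ) (β : ℝ) : Set (ℝ → ℝ) :=
  {f | ∃ p : Polynomial ℝ, p.natDegree ≤ N ∧ f = fun x => Real.exp (-(β * x / 2)) * p.eval x}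

/-- `p` is the `a_r^{α,β}`-orthogonal projection of `u` onto `X_N^β`. -/
def IsProj (r N : ℕ) (α β : ℝ) (u p : ℝ → ℝ) : Prop :=
  p ∈ X N β ∧ ∀ v ∈ X N β, form r α β (u - p) v = 0

open Classical in
/-- The orthogonal projection `π_{r,N}^{α,β} u` (with value `0` when there is none). -/
def proj (r N : ℕ) (α β : ℝ) (u : ℝ → ℝ) : ℝ → ℝ :=
  if h : ∃ p, IsProj r N α β u p then h.choose else 0

end

end Laguerre

/-! The Laguerre operator `β²x/4 - x∂² - (α+1)∂` is symmetric for all the forms `a_n` with `α + n >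
-1` at once. Put into one slot of `a_n`, it produces `a_{n+1}` plus a remainder that is symmetric in
both arguments; the binomial coefficients of the form are exactly what Pascal's rule needs for this
(`polyForm_laguerreOp`). On the factors `p` of `e^{-βx/2} p` it is triangular with distinct
eigenvalues `β(k + (α+1)/2)`. So there is one eigenpolynomial of each degree `k`, and together they
form a basis orthogonal for every `a_n`. Orthogonality to `X_N` then says that the coordinates `0,
…, N` vanish, a condition free of `n`; hence the projections of all orders agree on such functions
(`orthogonal_of_orthogonal`).

For the estimate, comparing `a_{n+1}` with the eigenvalue times `a_n` gives `a_{n+1} ≥ d β k a_n` on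
the `k`-th eigenpolynomial (`exists_eigen_le_succ`). Iterating from `s` to `r` and summing over `k >
N` gives `exists_polyForm_le`.

General `u` are reached by density (`exists_approx`). In `L²` this is determinacy of the moment
problem under exponential decay (`ae_eq_zero_of_moments`). For the derivatives one uses that `∂ -
β/2` maps the approximation spaces onto themselves, is bounded below, and has no kernel in the
weighted space. Since `a_s` is dominated by `a_r`, an approximating sequence of order `r` also
converges in order `s`; weak differentiation being closed, `u` lies in the space of order `s`, and
projections and estimates pass to the limit (`tendsto_polyEmb_of_le`, `exists_tendsto_proj`). -/

namespace Laguerre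

open Filter Topology

/-! ### Weighted `L²` spaces and weak derivatives. -/

/-- Lebesgue measure on the half line `(0, ∞)`. -/
noncomputable abbrev halfVol : Measure ℝ := volume.restrict (Ioi (0 : ℝ))

/-- The function `v` multiplied by the square root of the weight `x ^ γ`. -/
noncomputable def weighted (γ : ℝ) (v : ℝ → ℝ) : ℝ → ℝ := fun x => v x * x ^ (γ / 2)

lemma sq_rpow_half (γ : ℝ) {x : ℝ} (hx : 0 < x) : x ^ (γ / 2) * x ^ (γ / 2) = x ^ γ := by
  rw [← Real.rpow_add hx]; congr 1; ring

lemma rpow_half_mul_neg (γ : ℝ) {x : ℝ} (hx : 0 < x) : x ^ (γ / 2) * x ^ (-(γ / 2)) = 1 := by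
  rw [← Real.rpow_add hx]; simp

lemma ae_pos : ∀ᵐ x ∂halfVol, 0 < x := ae_restrict_mem measurableSet_Ioi

lemma measurable_rpow (γ : ℝ) : Measurable fun x : ℝ => x ^ γ := by fun_prop

/-- Multiplication by `x^{γ/2}` is an isometry onto the unweighted space, so completeness and the
inner product can be taken from `Lp`, for all weights in the same space. -/
lemma memL2_iff (γ : ℝ) (v : ℝ → ℝ) :
    MemL2 (powWeight γ) v ↔ MemLp (weighted γ v) 2 halfVol := by
  have key : (fun x => weighted γ v x ^ 2) =ᵐ[halfVol] fun x => v x ^ 2 * powWeight γ x := by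
    filter_upwards [ae_pos] with x hx
    simp only [weighted, powWeight]
    rw [← sq_rpow_half γ hx]; ring
  constructor
  · rintro ⟨h1, h2⟩
    have h3 : AEStronglyMeasurable (weighted γ v) halfVol :=
      h1.mul (measurable_rpow _).aestronglyMeasurable
    exact (memLp_two_iff_integrable_sq h3).2 (Integrable.congr h2 key.symm)
  · intro h
    refine ⟨?_, ?_⟩
    · have h3 : AEStronglyMeasurable (fun x => weighted γ v x * x ^ (-(γ / 2))) halfVol :=
        h.1.mul (measurable_rpow _).aestronglyMeasurable
      refine h3.congr ?_
      filter_upwards [ae_pos] with x hx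
      simp only [weighted]
      rw [mul_assoc, rpow_half_mul_neg γ hx, mul_one]
    · exact Integrable.congr ((memLp_two_iff_integrable_sq h.1).1 h) key

open Classical in
/-- The class of `v * x ^ (γ / 2)` in the unweighted space `L²(0, ∞)`. -/
noncomputable def toL2 (γ : ℝ) (v : ℝ → ℝ) : Lp ℝ 2 halfVol :=
  if h : MemLp (weighted γ v) 2 halfVol then h.toLp else 0

lemma toL2_eq {γ : ℝ} {v : ℝ → ℝ} (h : MemL2 (powWeight γ) v) :
    toL2 γ v = MemLp.toLp (weighted γ v) ((memL2_iff γ v).1 h) := by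
  rw [toL2, dif_pos]

lemma coeFn_toL2 {γ : ℝ} {v : ℝ → ℝ} (h : MemL2 (powWeight γ) v) :
    toL2 γ v =ᵐ[halfVol] weighted γ v := by
  rw [toL2_eq h]; exact MemLp.coeFn_toLp _

lemma toL2_eq_iff {γ : ℝ} {u v : ℝ → ℝ} (hu : MemL2 (powWeight γ) u)
    (hv : MemL2 (powWeight γ) v) : toL2 γ u = toL2 γ v ↔ u =ᵐ[halfVol] v := by
  rw [toL2_eq hu, toL2_eq hv, MemLp.toLp_eq_toLp_iff]
  constructor
  · intro h
    filter_upwards [h, ae_pos] with x hx h0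
    exact mul_right_cancel₀ (Real.rpow_pos_of_pos h0 _).ne' hx
  · intro h
    filter_upwards [h] with x hx
    simp [weighted, hx]

lemma MemL2.congr {γ : ℝ} {u v : ℝ → ℝ} (hu : MemL2 (powWeight γ) u) (h : u =ᵐ[halfVol] v) :
    MemL2 (powWeight γ) v := by
  rw [memL2_iff] at hu ⊢
  refine (memLp_congr_ae ?_).1 hu
  filter_upwards [h] with x hx
  simp [weighted, hx]

lemma MemL2.add {γ : ℝ} {u v : ℝ → ℝ} (hu : MemL2 (powWeight γ) u)
    (hv : MemL2 (powWeight γ) v) : MemL2 (powWeight γ) (u + v) := by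
  rw [memL2_iff] at hu hv ⊢
  have : weighted γ (u + v) = weighted γ u + weighted γ v := by
    ext x; simp [weighted, add_mul]
  rw [this]; exact hu.add hv

lemma MemL2.smul {γ : ℝ} {u : ℝ → ℝ} (hu : MemL2 (powWeight γ) u) (c : ℝ) :
    MemL2 (powWeight γ) (c • u) := by
  rw [memL2_iff] at hu ⊢
  have : weighted γ (c • u) = c • weighted γ u := by
    ext x; simp [weighted, mul_assoc]
  rw [this]; exact hu.const_smul c

lemma toL2_add {γ : ℝ} {u v : ℝ → ℝ} (hu : MemL2 (powWeight γ) u)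
    (hv : MemL2 (powWeight γ) v) : toL2 γ (u + v) = toL2 γ u + toL2 γ v := by
  rw [toL2_eq hu, toL2_eq hv, toL2_eq (hu.add hv), ← MemLp.toLp_add, MemLp.toLp_eq_toLp_iff]
  refine Eventually.of_forall fun x => ?_
  simp [weighted, add_mul]

lemma toL2_smul {γ : ℝ} {u : ℝ → ℝ} (hu : MemL2 (powWeight γ) u) (c : ℝ) :
    toL2 γ (c • u) = c • toL2 γ u := by
  rw [toL2_eq hu, toL2_eq (hu.smul c), ← MemLp.toLp_const_smul, MemLp.toLp_eq_toLp_iff]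
  refine Eventually.of_forall fun x => ?_
  simp [weighted, mul_assoc]

lemma MemL2.sub {γ : ℝ} {u v : ℝ → ℝ} (hu : MemL2 (powWeight γ) u)
    (hv : MemL2 (powWeight γ) v) : MemL2 (powWeight γ) (u - v) := by
  have := hu.add (hv.smul (-1))
  rwa [neg_one_smul, ← sub_eq_add_neg] at this

lemma toL2_sub {γ : ℝ} {u v : ℝ → ℝ} (hu : MemL2 (powWeight γ) u)
    (hv : MemL2 (powWeight γ) v) : toL2 γ (u - v) = toL2 γ u - toL2 γ v := by
  have := toL2_add hu (hv.smul (-1))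
  rwa [toL2_smul hv, neg_one_smul, neg_one_smul, ← sub_eq_add_neg, ← sub_eq_add_neg] at this

lemma inner_toL2 {γ : ℝ} {u v : ℝ → ℝ} (hu : MemL2 (powWeight γ) u)
    (hv : MemL2 (powWeight γ) v) :
    inner ℝ (toL2 γ u) (toL2 γ v) = innerL2 (powWeight γ) u v := by
  rw [L2.inner_def, innerL2]
  refine integral_congr_ae ?_
  filter_upwards [coeFn_toL2 hu, coeFn_toL2 hv, ae_pos] with x h1 h2 hx
  rw [h1, h2]
  simp only [weighted, powWeight, RCLike.inner_apply, conj_trivial]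
  rw [← sq_rpow_half γ hx]; ring

/-- The product of two functions of the weighted space is integrable. -/
lemma integrable_mul_of_memL2 {γ : ℝ} {u v : ℝ → ℝ} (hu : MemL2 (powWeight γ) u)
    (hv : MemL2 (powWeight γ) v) : Integrable (fun x => u x * v x * x ^ γ) halfVol := by
  refine ((((memL2_iff _ _).1 hu).integrable_mul ((memL2_iff _ _).1 hv))).congr ?_
  filter_upwards [ae_pos] with x hx
  simp only [weighted, Pi.mul_apply]
  rw [← sq_rpow_half γ hx]; ring

/-- Turns limits obtained from the completeness of `Lp` back into functions, to which weak
differentiation applies. -/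
lemma exists_toL2_eq (γ : ℝ) (f : Lp ℝ 2 halfVol) :
    ∃ v, MemL2 (powWeight γ) v ∧ toL2 γ v = f := by
  have h : weighted γ (fun x => f x * x ^ (-(γ / 2))) =ᵐ[halfVol] f := by
    filter_upwards [ae_pos] with x hx
    simp only [weighted]
    rw [mul_assoc, mul_comm (x ^ (-(γ / 2))), rpow_half_mul_neg γ hx, mul_one]
  have h2 : MemL2 (powWeight γ) (fun x => f x * x ^ (-(γ / 2))) :=
    (memL2_iff _ _).2 ((memLp_congr_ae h).2 (Lp.memLp f))
  exact ⟨_, h2, Lp.ext ((coeFn_toL2 h2).trans h)⟩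

/-- The weight is bounded below on compact subsets of `(0, ∞)`, so that the elements of the
weighted space are locally integrable there. -/
lemma MemL2.locallyIntegrableOn {γ : ℝ} {v : ℝ → ℝ} (h : MemL2 (powWeight γ) v) :
    LocallyIntegrableOn v (Ioi 0) volume := by
  have h1 : LocallyIntegrableOn (weighted γ v) (Ioi 0) volume := by
    have h2 := (((memL2_iff γ v).1 h).locallyIntegrable (by norm_num))
    exact locallyIntegrableOn_of_locallyIntegrable_restrict h2
  have h3 : LocallyIntegrableOn (fun x => weighted γ v x * x ^ (-(γ / 2))) (Ioi 0) volume := by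
    refine h1.mul_continuousOn ?_ (isOpen_Ioi.isLocallyClosed)
    intro x hx
    exact (Real.continuousAt_rpow_const x _ (Or.inl (ne_of_gt hx))).continuousWithinAt
  rw [locallyIntegrableOn_iff isOpen_Ioi.isLocallyClosed] at h3 ⊢
  intro K hK hKc
  refine (h3 K hK hKc).congr_fun ?_ hKc.measurableSet
  intro x hx
  simp only [weighted]
  rw [mul_assoc, rpow_half_mul_neg γ (hK hx), mul_one]

/-- Test functions on `(0, ∞)`. -/
structure IsTest (φ : ℝ → ℝ) : Prop where
  contDiff : ContDiff ℝ ∞ φ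
  compact : HasCompactSupport φ
  support : tsupport φ ⊆ Ioi 0

lemma IsTest.deriv {φ : ℝ → ℝ} (h : IsTest φ) : IsTest (deriv φ) :=
  ⟨(contDiff_infty_iff_deriv.1 h.contDiff).2, h.compact.deriv,
    tsupport_deriv_subset.trans h.support⟩

lemma IsTest.iteratedDeriv {φ : ℝ → ℝ} (h : IsTest φ) (k : ℕ) : IsTest (iteratedDeriv k φ) := by
  induction k with
  | zero => simpa using h
  | succ k ih => rw [iteratedDeriv_succ]; exact ih.deriv

lemma IsTest.mul_smooth {φ f : ℝ → ℝ} (h : IsTest φ) (hf : ContDiff ℝ ∞ f) :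
    IsTest (fun x => φ x * f x) :=
  ⟨h.contDiff.mul hf, h.compact.mul_right, (tsupport_mul_subset_left).trans h.support⟩

lemma IsTest.sub {φ ψ : ℝ → ℝ} (h : IsTest φ) (h' : IsTest ψ) : IsTest (φ - ψ) :=
  ⟨h.contDiff.sub h'.contDiff, h.compact.sub h'.compact,
    (tsupport_sub φ ψ).trans (union_subset h.support h'.support)⟩

lemma IsTest.smul {φ : ℝ → ℝ} (h : IsTest φ) (c : ℝ) : IsTest (c • φ) :=
  ⟨h.contDiff.const_smul c, h.compact.smul_left (f := fun _ => c),
    (tsupport_smul_subset_right (fun _ => c) φ).trans h.support⟩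

/-- Locally integrable functions may be integrated against test functions. -/
lemma integrable_mul_test {u φ : ℝ → ℝ} (hu : LocallyIntegrableOn u (Ioi 0) volume)
    (h : IsTest φ) : Integrable (fun x => u x * φ x) halfVol := by
  have h1 : IntegrableOn u (tsupport φ) volume :=
    hu.integrableOn_compact_subset h.support h.compact
  have h2 : IntegrableOn (fun x => u x * φ x) (tsupport φ) volume :=
    h1.mul_continuousOn h.contDiff.continuous.continuousOn h.compact
  have h3 : Integrable (fun x => u x * φ x) volume := by
    refine (integrableOn_iff_integrable_of_support_subset ?_).1 h2
    intro x hx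
    exact subset_tsupport _ (right_ne_zero_of_mul hx)
  exact h3.restrict

lemma isWeakDeriv_iff {k : ℕ} {u g : ℝ → ℝ} : IsWeakDeriv k u g ↔
    LocallyIntegrableOn u (Ioi 0) volume ∧ LocallyIntegrableOn g (Ioi 0) volume ∧
    ∀ φ, IsTest φ → ∫ x, u x * iteratedDeriv k φ x ∂halfVol = (-1) ^ k * ∫ x, g x * φ x ∂halfVol :=
  ⟨fun h => ⟨h.1, h.2.1, fun φ hφ => h.2.2 φ hφ.1 hφ.2 hφ.3⟩,
    fun h => ⟨h.1, h.2.1, fun φ h1 h2 h3 => h.2.2 φ ⟨h1, h2, h3⟩⟩⟩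

lemma ae_eq_of_forall_test {u v : ℝ → ℝ} (hu : LocallyIntegrableOn u (Ioi 0) volume)
    (hv : LocallyIntegrableOn v (Ioi 0) volume)
    (h : ∀ φ, IsTest φ → ∫ x, u x * φ x ∂halfVol = ∫ x, v x * φ x ∂halfVol) :
    u =ᵐ[halfVol] v := by
  have := isOpen_Ioi.ae_eq_zero_of_integral_contDiff_smul_eq_zero (hu.sub hv) (fun φ h1 h2 h3 => by
    have ht : IsTest φ := ⟨h1, h2, h3⟩
    have h4 := h φ ht
    rw [← sub_eq_zero, ← integral_sub (integrable_mul_test hu ht) (integrable_mul_test hv ht)] at h4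
    rw [← setIntegral_eq_integral_of_forall_compl_eq_zero (s := Ioi 0)]
    · refine Eq.trans (integral_congr_ae (Eventually.of_forall fun x => ?_)) h4
      simp only [Pi.sub_apply, smul_eq_mul]; ring
    · intro x hx
      have : φ x = 0 := by
        by_contra h5; exact hx (h3 (subset_tsupport _ h5))
      simp [this])
  rw [EventuallyEq, ae_restrict_iff' measurableSet_Ioi]
  filter_upwards [this] with x hx h0
  exact sub_eq_zero.1 (hx h0)

lemma IsWeakDeriv.ae_unique {k : ℕ} {u g g' : ℝ → ℝ} (h : IsWeakDeriv k u g)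
    (h' : IsWeakDeriv k u g') : g =ᵐ[halfVol] g' := by
  rw [isWeakDeriv_iff] at h h'
  refine ae_eq_of_forall_test h.2.1 h'.2.1 fun φ hφ => ?_
  have := (h.2.2 φ hφ).symm.trans (h'.2.2 φ hφ)
  exact mul_left_cancel₀ (pow_ne_zero _ (by norm_num)) this

lemma locallyIntegrableOn_congr {u v : ℝ → ℝ} (h : u =ᵐ[halfVol] v)
    (hu : LocallyIntegrableOn u (Ioi 0) volume) : LocallyIntegrableOn v (Ioi 0) volume := by
  rw [locallyIntegrableOn_iff isOpen_Ioi.isLocallyClosed] at hu ⊢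
  intro K hK hKc
  exact (hu K hK hKc).congr (ae_restrict_of_ae_restrict_of_subset hK h)

lemma IsWeakDeriv.congr {k : ℕ} {u u' g g' : ℝ → ℝ} (h : IsWeakDeriv k u g)
    (hu : u =ᵐ[halfVol] u') (hg : g =ᵐ[halfVol] g') : IsWeakDeriv k u' g' := by
  rw [isWeakDeriv_iff] at h ⊢
  refine ⟨locallyIntegrableOn_congr hu h.1, locallyIntegrableOn_congr hg h.2.1, fun φ hφ => ?_⟩
  have h1 : ∫ x, u' x * iteratedDeriv k φ x ∂halfVol = ∫ x, u x * iteratedDeriv k φ x ∂halfVol :=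
    integral_congr_ae (by filter_upwards [hu] with x hx; rw [hx])
  have h2 : ∫ x, g' x * φ x ∂halfVol = ∫ x, g x * φ x ∂halfVol :=
    integral_congr_ae (by filter_upwards [hg] with x hx; rw [hx])
  rw [h1, h2, h.2.2 φ hφ]

lemma IsWeakDeriv.add {k : ℕ} {u u' g g' : ℝ → ℝ} (h : IsWeakDeriv k u g)
    (h' : IsWeakDeriv k u' g') : IsWeakDeriv k (u + u') (g + g') := by
  rw [isWeakDeriv_iff] at *
  refine ⟨h.1.add h'.1, h.2.1.add h'.2.1, fun φ hφ => ?_⟩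
  simp only [Pi.add_apply, add_mul]
  rw [integral_add (integrable_mul_test h.1 (hφ.iteratedDeriv k))
    (integrable_mul_test h'.1 (hφ.iteratedDeriv k)),
    integral_add (integrable_mul_test h.2.1 hφ) (integrable_mul_test h'.2.1 hφ),
    h.2.2 φ hφ, h'.2.2 φ hφ, mul_add]

lemma IsWeakDeriv.smul {k : ℕ} {u g : ℝ → ℝ} (h : IsWeakDeriv k u g) (c : ℝ) :
    IsWeakDeriv k (c • u) (c • g) := by
  rw [isWeakDeriv_iff] at *
  refine ⟨h.1.smul c, h.2.1.smul c, fun φ hφ => ?_⟩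
  simp only [Pi.smul_apply, smul_eq_mul, mul_assoc]
  rw [integral_const_mul, integral_const_mul, h.2.2 φ hφ]
  ring

lemma IsWeakDeriv.sub {k : ℕ} {u u' g g' : ℝ → ℝ} (h : IsWeakDeriv k u g)
    (h' : IsWeakDeriv k u' g') : IsWeakDeriv k (u - u') (g - g') := by
  have := h.add (h'.smul (-1))
  rwa [neg_one_smul, neg_one_smul, ← sub_eq_add_neg, ← sub_eq_add_neg] at this

lemma isWeakDeriv_zero {u : ℝ → ℝ} (h : LocallyIntegrableOn u (Ioi 0) volume) :
    IsWeakDeriv 0 u u := by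
  rw [isWeakDeriv_iff]
  exact ⟨h, h, fun φ _ => by simp⟩

lemma IsWeakDeriv.succ {k : ℕ} {u g h : ℝ → ℝ} (h1 : IsWeakDeriv k u g)
    (h2 : IsWeakDeriv 1 g h) : IsWeakDeriv (k + 1) u h := by
  rw [isWeakDeriv_iff] at *
  refine ⟨h1.1, h2.2.1, fun φ hφ => ?_⟩
  have h3 := h2.2.2 φ hφ
  rw [iteratedDeriv_one] at h3
  rw [iteratedDeriv_succ', h1.2.2 _ hφ.deriv, h3, pow_succ]
  ring

/-- Test the derivative of order `k` with `φ'`. This turns the weak derivatives of one function into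
a chain of first-order relations, the form in which `exists_approx` uses them. -/
lemma IsWeakDeriv.of_succ {k : ℕ} {u g h : ℝ → ℝ} (h1 : IsWeakDeriv k u g)
    (h2 : IsWeakDeriv (k + 1) u h) : IsWeakDeriv 1 g h := by
  rw [isWeakDeriv_iff] at *
  refine ⟨h1.2.1, h2.2.1, fun φ hφ => ?_⟩
  have h3 := h2.2.2 φ hφ
  rw [iteratedDeriv_succ', h1.2.2 _ hφ.deriv, pow_succ, mul_assoc] at h3
  rw [iteratedDeriv_one, pow_one]
  exact mul_left_cancel₀ (pow_ne_zero _ (by norm_num)) h3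

lemma isWeakDeriv_weakDeriv {k : ℕ} {u g : ℝ → ℝ} (h : IsWeakDeriv k u g) :
    IsWeakDeriv k u (weakDeriv k u) := by
  have h' : ∃ g, IsWeakDeriv k u g := ⟨g, h⟩
  rw [weakDeriv, dif_pos h']
  exact h'.choose_spec

lemma IsWeakDeriv.weakDeriv_ae {k : ℕ} {u g : ℝ → ℝ} (h : IsWeakDeriv k u g) :
    weakDeriv k u =ᵐ[halfVol] g :=
  (isWeakDeriv_weakDeriv h).ae_unique h

lemma MemH.isWeakDeriv {m k : ℕ} {ϖ u : ℝ → ℝ} (h : MemH m ϖ u) (hk : k ≤ m) :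
    IsWeakDeriv k u (weakDeriv k u) := by
  obtain ⟨g, hg, -⟩ := h k hk
  exact isWeakDeriv_weakDeriv hg

lemma MemH.memL2 {m k : ℕ} {γ : ℝ} {u : ℝ → ℝ} (h : MemH m (powWeight γ) u) (hk : k ≤ m) :
    MemL2 (powWeight γ) (weakDeriv k u) := by
  obtain ⟨g, hg, hg'⟩ := h k hk
  exact hg'.congr hg.weakDeriv_ae.symm

lemma MemH.sub {m : ℕ} {γ : ℝ} {u v : ℝ → ℝ} (h : MemH m (powWeight γ) u)
    (h' : MemH m (powWeight γ) v) : MemH m (powWeight γ) (u - v) := fun _ hk =>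
  ⟨_, (h.isWeakDeriv hk).sub (h'.isWeakDeriv hk), (h.memL2 hk).sub (h'.memL2 hk)⟩

lemma MemH.weakDeriv_sub {m k : ℕ} {γ : ℝ} {u v : ℝ → ℝ} (h : MemH m (powWeight γ) u)
    (h' : MemH m (powWeight γ) v) (hk : k ≤ m) :
    weakDeriv k (u - v) =ᵐ[halfVol] weakDeriv k u - weakDeriv k v :=
  ((h.isWeakDeriv hk).sub (h'.isWeakDeriv hk)).weakDeriv_ae

lemma isWeakDeriv_one_of_contDiff {u : ℝ → ℝ} (hu : ContDiff ℝ ∞ u) :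
    IsWeakDeriv 1 u (deriv u) := by
  rw [isWeakDeriv_iff]
  have hu' := (contDiff_infty_iff_deriv.1 hu).2
  refine ⟨(hu.continuous.locallyIntegrable).locallyIntegrableOn _,
    (hu'.continuous.locallyIntegrable).locallyIntegrableOn _, fun φ hφ => ?_⟩
  -- Against test functions one may integrate over the whole line, where integration by parts has no
  -- boundary terms.
  have e : ∀ {f ψ : ℝ → ℝ}, IsTest ψ →
      ∫ x, f x * ψ x ∂halfVol = ∫ x, f x * ψ x := fun {f ψ} hψ => by
    refine setIntegral_eq_integral_of_forall_compl_eq_zero fun x hx => ?_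
    have : ψ x = 0 := by
      by_contra h5; exact hx (hψ.support (subset_tsupport _ h5))
    simp [this]
  have i : ∀ {f ψ : ℝ → ℝ}, Continuous f → IsTest ψ → Integrable (f * ψ) volume :=
    fun hf hψ => (hf.mul hψ.contDiff.continuous).integrable_of_hasCompactSupport
      hψ.compact.mul_left
  rw [iteratedDeriv_one, e hφ.deriv, e hφ]
  have := integral_mul_deriv_eq_deriv_mul_of_integrable (u := u) (v := φ) (u' := deriv u)
    (v' := deriv φ) (fun x _ => (hu.differentiable (by simp) x).hasDerivAt)
    (fun x _ => (hφ.contDiff.differentiable (by simp) x).hasDerivAt)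
    (i hu.continuous hφ.deriv) (i hu'.continuous hφ) (i hu.continuous hφ)
  rw [this]; simp

lemma isWeakDeriv_of_contDiff {u : ℝ → ℝ} (hu : ContDiff ℝ ∞ u) (k : ℕ) :
    IsWeakDeriv k u (iteratedDeriv k u) := by
  induction k with
  | zero =>
    rw [iteratedDeriv_zero]
    exact isWeakDeriv_zero ((hu.continuous.locallyIntegrable).locallyIntegrableOn _)
  | succ k ih =>
    rw [iteratedDeriv_succ]
    refine ih.succ (isWeakDeriv_one_of_contDiff ?_)
    rw [iteratedDeriv_eq_iterate]; exact hu.iterate_deriv k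

/-- Integration against a test function is continuous on the weighted space. -/
lemma tendsto_integral_test {γ : ℝ} {v : ℕ → ℝ → ℝ} {u φ : ℝ → ℝ}
    (hv : ∀ j, MemL2 (powWeight γ) (v j)) (hu : MemL2 (powWeight γ) u)
    (h : Tendsto (fun j => toL2 γ (v j)) atTop (𝓝 (toL2 γ u))) (hφ : IsTest φ) :
    Tendsto (fun j => ∫ x, v j x * φ x ∂halfVol) atTop (𝓝 (∫ x, u x * φ x ∂halfVol)) := by
  -- Integration against `φ` is the weighted inner product with `φ x^{-γ}`, which lies in the space
  -- because the support of `φ` stays away from `0`.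
  have hψ : MemL2 (powWeight γ) (fun x => φ x * x ^ (-γ)) := by
    refine ⟨hφ.contDiff.continuous.aestronglyMeasurable.mul
      (measurable_rpow _).aestronglyMeasurable, ?_⟩
    have h0 : LocallyIntegrableOn (fun x : ℝ => x ^ (-γ)) (Ioi 0) volume := by
      refine ContinuousOn.locallyIntegrableOn ?_ measurableSet_Ioi
      intro x hx
      exact (Real.continuousAt_rpow_const x _ (Or.inl (ne_of_gt hx))).continuousWithinAt
    have h1 := integrable_mul_test h0 (hφ.mul_smooth hφ.contDiff)
    refine Integrable.congr h1 ?_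
    filter_upwards [ae_pos] with x hx
    have : x ^ (-γ) * x ^ γ = 1 := by rw [← Real.rpow_add hx]; simp
    simp only [powWeight]
    linear_combination (-(φ x * φ x) * x ^ (-γ)) * this
  have e : ∀ w, MemL2 (powWeight γ) w →
      ∫ x, w x * φ x ∂halfVol = inner ℝ (toL2 γ w) (toL2 γ (fun x => φ x * x ^ (-γ))) := by
    intro w hw
    rw [inner_toL2 hw hψ, innerL2]
    refine integral_congr_ae ?_
    filter_upwards [ae_pos] with x hx
    have : x ^ (-γ) * x ^ γ = 1 := by rw [← Real.rpow_add hx]; simp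
    simp only [powWeight]
    linear_combination (-(w x * φ x)) * this
  rw [e u hu]
  simp only [fun j => e (v j) (hv j)]
  exact h.inner tendsto_const_nhds

/-- Weak differentiation is a closed operation, also if the weights of the two limits differ. -/
lemma isWeakDeriv_of_tendsto {γ γ' : ℝ} {k : ℕ} {v w : ℕ → ℝ → ℝ} {u g : ℝ → ℝ}
    (hv : ∀ j, MemL2 (powWeight γ) (v j)) (hu : MemL2 (powWeight γ) u)
    (hw : ∀ j, MemL2 (powWeight γ') (w j)) (hg : MemL2 (powWeight γ') g)
    (hvw : ∀ j, IsWeakDeriv k (v j) (w j))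
    (h : Tendsto (fun j => toL2 γ (v j)) atTop (𝓝 (toL2 γ u)))
    (h' : Tendsto (fun j => toL2 γ' (w j)) atTop (𝓝 (toL2 γ' g))) : IsWeakDeriv k u g := by
  rw [isWeakDeriv_iff]
  refine ⟨hu.locallyIntegrableOn, hg.locallyIntegrableOn, fun φ hφ => ?_⟩
  have h1 := tendsto_integral_test hv hu h (hφ.iteratedDeriv k)
  have h2 := (tendsto_integral_test hw hg h' hφ).const_mul ((-1 : ℝ) ^ k)
  refine tendsto_nhds_unique h1 (h2.congr fun j => ?_)
  exact ((isWeakDeriv_iff.1 (hvw j)).2.2 φ hφ).symm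

end Laguerre

/-! ### The approximation space and integration by parts on polynomial factors. -/

namespace Laguerre

open Filter Topology Polynomial

/-- The element `e^{-βx/2} p(x)` of the approximation space. -/
noncomputable def expPoly (β : ℝ) (p : ℝ[X]) : ℝ → ℝ :=
  fun x => Real.exp (-(β * x / 2)) * p.eval x

/-- Differentiation of `e^{-βx/2} p(x)` in terms of the polynomial factor. -/
noncomputable def expDeriv (β : ℝ) : ℝ[X] →ₗ[ℝ] ℝ[X] :=
  derivative - (β / 2) • LinearMap.id

lemma expDeriv_apply (β : ℝ) (p : ℝ[X]) : expDeriv β p = derivative p - (β / 2) • p := rfl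

lemma hasDerivAt_expPoly (β : ℝ) (p : ℝ[X]) (x : ℝ) :
    HasDerivAt (expPoly β p) (expPoly β (expDeriv β p) x) x := by
  have h1 : HasDerivAt (fun x : ℝ => -(β * x / 2)) (-(β / 2)) x := by
    refine ((((hasDerivAt_id x).const_mul β).div_const 2).neg).congr_deriv ?_
    ring
  have h2 := h1.exp.mul (p.hasDerivAt x)
  refine h2.congr_deriv ?_
  simp only [expPoly, expDeriv_apply, eval_sub, eval_smul, smul_eq_mul]
  ring

lemma deriv_expPoly (β : ℝ) (p : ℝ[X]) : deriv (expPoly β p) = expPoly β (expDeriv β p) :=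
  funext fun x => (hasDerivAt_expPoly β p x).deriv

lemma iteratedDeriv_expPoly (β : ℝ) (p : ℝ[X]) (k : ℕ) :
    iteratedDeriv k (expPoly β p) = expPoly β ((expDeriv β ^ k) p) := by
  induction k with
  | zero => simp
  | succ k ih => rw [iteratedDeriv_succ, ih, deriv_expPoly, pow_succ', Module.End.mul_apply]

lemma contDiff_expPoly (β : ℝ) (p : ℝ[X]) : ContDiff ℝ ∞ (expPoly β p) := by
  unfold expPoly
  have : ContDiff ℝ ∞ fun x => p.eval x := by
    have := p.contDiff_aeval (𝕜 := ℝ) ∞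
    simpa using this
  fun_prop

lemma expPoly_sub (β : ℝ) (p q : ℝ[X]) : expPoly β (p - q) = expPoly β p - expPoly β q := by
  ext x; simp [expPoly, mul_sub]

lemma expPoly_add (β : ℝ) (p q : ℝ[X]) : expPoly β (p + q) = expPoly β p + expPoly β q := by
  ext x; simp [expPoly, mul_add]

lemma expPoly_smul (β c : ℝ) (p : ℝ[X]) : expPoly β (c • p) = c • expPoly β p := by
  ext x; simp [expPoly]; ring

lemma expPoly_injective (β : ℝ) : Function.Injective (expPoly β) := by
  intro p q h
  refine Polynomial.funext fun x => ?_
  have := congrFun h x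
  exact mul_left_cancel₀ (Real.exp_ne_zero _) this

lemma integrable_rpow_mul_exp {β γ : ℝ} (hβ : 0 < β) (hγ : -1 < γ) :
    Integrable (fun x => x ^ γ * Real.exp (-(β * x))) halfVol := by
  have := integrableOn_rpow_mul_exp_neg_mul_rpow (p := 1) hγ one_pos hβ
  simpa [IntegrableOn] using this

lemma integrable_monomial {β γ : ℝ} (hβ : 0 < β) (hγ : -1 < γ) (k : ℕ) :
    Integrable (fun x => x ^ k * Real.exp (-(β * x)) * x ^ γ) halfVol := by
  have h := integrable_rpow_mul_exp (γ := γ + k) hβ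
    (lt_of_lt_of_le hγ (by linarith [(Nat.cast_nonneg k : (0 : ℝ) ≤ k)]))
  refine h.congr ?_
  filter_upwards [ae_pos] with x hx
  rw [Real.rpow_add hx, Real.rpow_natCast]; ring

lemma integrable_poly {β γ : ℝ} (hβ : 0 < β) (hγ : -1 < γ) (p : ℝ[X]) :
    Integrable (fun x => p.eval x * Real.exp (-(β * x)) * x ^ γ) halfVol := by
  induction p using Polynomial.induction_on' with
  | add p q hp hq =>
    refine (hp.add hq).congr (Eventually.of_forall fun x => ?_)
    simp only [Pi.add_apply, eval_add]; ring
  | monomial k a =>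
    refine ((integrable_monomial hβ hγ k).const_mul a).congr (Eventually.of_forall fun x => ?_)
    simp only [eval_monomial]; ring

/-- The functional `p ↦ ∫₀^∞ p(x) e^{-βx} x^γ dx`. -/
noncomputable def moment (β γ : ℝ) (p : ℝ[X]) : ℝ :=
  ∫ x, p.eval x * Real.exp (-(β * x)) * x ^ γ ∂halfVol

lemma moment_add {β γ : ℝ} (hβ : 0 < β) (hγ : -1 < γ) (p q : ℝ[X]) :
    moment β γ (p + q) = moment β γ p + moment β γ q := by
  rw [moment, moment, moment, ← integral_add (integrable_poly hβ hγ p) (integrable_poly hβ hγ q)]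
  congr 1; ext x; simp only [eval_add]; ring

lemma moment_smul (β γ c : ℝ) (p : ℝ[X]) : moment β γ (c • p) = c * moment β γ p := by
  rw [moment, moment, ← integral_const_mul]
  congr 1; ext x; simp only [eval_smul, smul_eq_mul]; ring

lemma moment_sub {β γ : ℝ} (hβ : 0 < β) (hγ : -1 < γ) (p q : ℝ[X]) :
    moment β γ (p - q) = moment β γ p - moment β γ q := by
  rw [sub_eq_add_neg, ← neg_one_smul ℝ q, moment_add hβ hγ, moment_smul]; ring

lemma moment_X_mul (β γ : ℝ) (p : ℝ[X]) : moment β γ (Polynomial.X * p) = moment β (γ + 1) p := by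
  refine integral_congr_ae ?_
  filter_upwards [ae_pos] with x hx
  rw [Real.rpow_add_one hx.ne']
  simp only [eval_mul, eval_X]; ring

lemma moment_X_pow {β γ : ℝ} (hβ : 0 < β) (hγ : -1 < γ) (k : ℕ) :
    moment β γ (Polynomial.X ^ k) = (1 / β) ^ (γ + k + 1) * Real.Gamma (γ + k + 1) := by
  have hk : (0 : ℝ) ≤ k := Nat.cast_nonneg k
  rw [← Real.integral_rpow_mul_exp_neg_mul_Ioi (by linarith) hβ]
  refine integral_congr_ae ?_
  filter_upwards [ae_pos] with x hx
  rw [show γ + k + 1 - 1 = γ + k by ring, Real.rpow_add hx, Real.rpow_natCast]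
  simp only [eval_pow, eval_X]; ring

/-- Integration by parts for the functional `moment`. -/
lemma moment_derivative {β γ : ℝ} (hβ : 0 < β) (hγ : -1 < γ) (p : ℝ[X]) :
    moment β (γ + 1) (derivative p - β • p) = -(γ + 1) * moment β γ p := by
  have hγ' : -1 < γ + 1 := by linarith
  induction p using Polynomial.induction_on' with
  | add p q hp hq =>
    rw [moment_add hβ hγ, mul_add, ← hp, ← hq, ← moment_add hβ hγ']
    congr 1; simp only [derivative_add, smul_add]; ring
  | monomial k a =>
    rw [← C_mul_X_pow_eq_monomial, ← smul_eq_C_mul]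
    have hb : (1 / β) ≠ 0 := (by positivity)
    -- For a monomial the identity is the functional equation of the Gamma function, and no boundary
    -- term has to be discussed.
    have key : moment β (γ + 1) (derivative (Polynomial.X ^ k) - β • Polynomial.X ^ k) = -(γ + 1) * moment β γ (Polynomial.X ^ k) := by
      have hk : (0 : ℝ) ≤ k := Nat.cast_nonneg k
      have hG : Real.Gamma (γ + k + 1 + 1) = (γ + k + 1) * Real.Gamma (γ + k + 1) :=
        Real.Gamma_add_one (by linarith)
      have hB : (1 / β : ℝ) ^ (γ + k + 1 + 1) = (1 / β) ^ (γ + k + 1) * (1 / β) :=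
        Real.rpow_add_one hb _
      have h2 : moment β (γ + 1) (Polynomial.X ^ k) =
          (1 / β) ^ (γ + k + 1) * (1 / β) * ((γ + k + 1) * Real.Gamma (γ + k + 1)) := by
        rw [moment_X_pow hβ hγ', ← hG, ← hB]; ring_nf
      rcases k with _ | k
      · rw [moment_X_pow hβ hγ 0]
        simp only [pow_zero, derivative_one, zero_sub] at h2 ⊢
        rw [← neg_smul, moment_smul, h2]
        field_simp
        push_cast; ring
      · rw [moment_X_pow hβ hγ (k + 1), derivative_X_pow, moment_sub hβ hγ', moment_smul, h2,
          ← smul_eq_C_mul, moment_smul, moment_X_pow hβ hγ']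
        have e : γ + 1 + ((k + 1 - 1 : ℕ) : ℝ) + 1 = γ + ((k + 1 : ℕ) : ℝ) + 1 := by
          push_cast [Nat.add_sub_cancel]; ring
        rw [e]
        field_simp
        ring
    rw [derivative_smul, smul_comm β a, ← smul_sub, moment_smul, moment_smul, key]; ring

/-- The two shifts by `-β/2` in the product rule add up to the `-β` of `moment_derivative`. -/
lemma moment_expDeriv {β γ : ℝ} (hβ : 0 < β) (hγ : -1 < γ) (p q : ℝ[X]) :
    moment β (γ + 1) (expDeriv β p * q) + moment β (γ + 1) (p * expDeriv β q) =
      -(γ + 1) * moment β γ (p * q) := by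
  rw [← moment_derivative hβ hγ, ← moment_add hβ (by linarith)]
  congr 1
  simp only [expDeriv_apply, derivative_mul, sub_mul, mul_sub, smul_mul_assoc, mul_smul_comm]
  have : β • (p * q) = (β / 2) • (p * q) + (β / 2) • (p * q) := by
    rw [← add_smul]; congr 1; ring
  rw [this]; ring

lemma innerL2_expPoly (β γ : ℝ) (p q : ℝ[X]) :
    innerL2 (powWeight γ) (expPoly β p) (expPoly β q) = moment β γ (p * q) := by
  refine integral_congr_ae (Eventually.of_forall fun x => ?_)
  simp only [expPoly, powWeight, eval_mul]
  have : Real.exp (-(β * x)) = Real.exp (-(β * x / 2)) * Real.exp (-(β * x / 2)) := by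
    rw [← Real.exp_add]; congr 1; ring
  rw [this]; ring

lemma memL2_expPoly {β γ : ℝ} (hβ : 0 < β) (hγ : -1 < γ) (p : ℝ[X]) :
    MemL2 (powWeight γ) (expPoly β p) := by
  refine ⟨(contDiff_expPoly β p).continuous.aestronglyMeasurable, ?_⟩
  refine (integrable_poly hβ hγ (p * p)).congr (Eventually.of_forall fun x => ?_)
  simp only [expPoly, powWeight, eval_mul]
  have : Real.exp (-(β * x)) = Real.exp (-(β * x / 2)) * Real.exp (-(β * x / 2)) := by
    rw [← Real.exp_add]; congr 1; ring
  rw [this]; ring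

lemma isWeakDeriv_expPoly (β : ℝ) (p : ℝ[X]) (k : ℕ) :
    IsWeakDeriv k (expPoly β p) (expPoly β ((expDeriv β ^ k) p)) := by
  rw [← iteratedDeriv_expPoly]
  exact isWeakDeriv_of_contDiff (contDiff_expPoly β p) k

lemma memH_expPoly {β γ : ℝ} (hβ : 0 < β) (hγ : -1 < γ) (m : ℕ) (p : ℝ[X]) :
    MemH m (powWeight γ) (expPoly β p) := fun k _ =>
  ⟨_, isWeakDeriv_expPoly β p k, memL2_expPoly hβ hγ _⟩

lemma moment_mul_self_nonneg (β γ : ℝ) (p : ℝ[X]) : 0 ≤ moment β γ (p * p) := by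
  refine integral_nonneg_of_ae ?_
  filter_upwards [ae_pos] with x hx
  simp only [eval_mul]
  have := mul_self_nonneg (p.eval x)
  positivity

/-- A vanishing integral would force `p = 0` almost everywhere, but a nonzero polynomial has
finitely many roots. -/
lemma moment_mul_self_pos {β γ : ℝ} (hβ : 0 < β) (hγ : -1 < γ) {p : ℝ[X]} (hp : p ≠ 0) :
    0 < moment β γ (p * p) := by
  refine lt_of_le_of_ne (moment_mul_self_nonneg β γ p) fun h => hp ?_
  have h1 := (integral_eq_zero_iff_of_nonneg_ae (by
    filter_upwards [ae_pos] with x hx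
    simp only [eval_mul]
    have := mul_self_nonneg (p.eval x)
    simp only [Pi.zero_apply]
    positivity) (integrable_poly hβ hγ (p * p))).1 h.symm
  have h2 : ∀ᵐ x ∂halfVol, p.eval x = 0 := by
    filter_upwards [h1, ae_pos] with x hx h0
    have h3 : Real.exp (-(β * x)) ≠ 0 := Real.exp_ne_zero _
    have h4 : x ^ γ ≠ 0 := (Real.rpow_pos_of_pos h0 _).ne'
    simpa [h3, h4] using hx
  by_contra hp
  have h3 : (halfVol {x | p.eval x ≠ 0}) = 0 := h2
  have h5 : volume (Ioi (0 : ℝ)) ≤ 0 := by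
    have h6 : halfVol univ ≤ halfVol {x | p.eval x ≠ 0} + halfVol {x | p.eval x = 0} := by
      refine le_trans (measure_mono ?_) (measure_union_le _ _)
      intro x _
      by_cases h : p.eval x = 0
      · exact Or.inr h
      · exact Or.inl h
    have h7 : halfVol {x | p.eval x = 0} = 0 := by
      refine Set.Finite.measure_zero ?_ _
      refine (p.roots.toFinset.finite_toSet).subset fun x hx => ?_
      simp only [mem_ofPred_eq] at hx
      simp [hp, hx]
    rw [h3, h7] at h6
    simp at h6
  simp at h5

end Laguerre

/-! ### The forms on polynomials and the symmetry of the Laguerre operator. -/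

namespace Laguerre

open Filter Topology Polynomial

/-- The form `a_n^{α,β}` on the polynomial factors of the elements of the approximation space. -/
noncomputable def polyForm (n : ℕ) (α β : ℝ) (p q : ℝ[X]) : ℝ :=
  ∑ ν ∈ Finset.range (n + 1), (n.choose ν : ℝ) * ((β / 2) ^ 2) ^ (n - ν) *
    moment β (α + n) ((expDeriv β ^ ν) p * (expDeriv β ^ ν) q)

lemma innerL2_congr {ϖ u u' v v' : ℝ → ℝ} (hu : u =ᵐ[halfVol] u') (hv : v =ᵐ[halfVol] v') :
    innerL2 ϖ u v = innerL2 ϖ u' v' := by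
  refine integral_congr_ae ?_
  filter_upwards [hu, hv] with x h1 h2
  rw [h1, h2]

lemma form_coeff (n ν : ℕ) (β : ℝ) :
    β ^ (2 * n - 2 * ν) / 2 ^ (2 * n - 2 * ν) = ((β / 2) ^ 2) ^ (n - ν) := by
  rw [← div_pow, ← pow_mul, Nat.mul_sub]

lemma form_expPoly (n : ℕ) (α β : ℝ) (p q : ℝ[X]) :
    form n α β (expPoly β p) (expPoly β q) = polyForm n α β p q := by
  refine Finset.sum_congr rfl fun ν _ => ?_
  rw [form_coeff, innerL2_congr (isWeakDeriv_expPoly β p ν).weakDeriv_ae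
    (isWeakDeriv_expPoly β q ν).weakDeriv_ae, innerL2_expPoly]

section Form

variable {α β : ℝ} {n : ℕ}

lemma polyForm_comm (n : ℕ) (α β : ℝ) (p q : ℝ[X]) : polyForm n α β p q = polyForm n α β q p := by
  simp only [polyForm, mul_comm ((expDeriv β ^ _) p)]

lemma polyForm_add_left (hβ : 0 < β) (hn : -1 < α + n) (p p' q : ℝ[X]) :
    polyForm n α β (p + p') q = polyForm n α β p q + polyForm n α β p' q := by
  simp only [polyForm, map_add, add_mul, moment_add hβ hn, mul_add, Finset.sum_add_distrib]

lemma polyForm_smul_left (n : ℕ) (α β c : ℝ) (p q : ℝ[X]) :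
    polyForm n α β (c • p) q = c * polyForm n α β p q := by
  simp only [polyForm, map_smul, smul_mul_assoc, moment_smul, Finset.mul_sum]
  exact Finset.sum_congr rfl fun _ _ => by ring

/-- The form as a linear map in its first argument. -/
noncomputable def polyFormLin (n : ℕ) (hβ : 0 < β) (hn : -1 < α + n) (q : ℝ[X]) : ℝ[X] →ₗ[ℝ] ℝ where
  toFun p := polyForm n α β p q
  map_add' p p' := polyForm_add_left hβ hn p p' q
  map_smul' c p := polyForm_smul_left n α β c p q

lemma polyForm_self_nonneg (n : ℕ) (α β : ℝ) (p : ℝ[X]) : 0 ≤ polyForm n α β p p :=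
  Finset.sum_nonneg fun ν _ => mul_nonneg (by positivity) (moment_mul_self_nonneg _ _ _)

lemma polyForm_self_pos (hβ : 0 < β) (hn : -1 < α + n) {p : ℝ[X]} (hp : p ≠ 0) :
    0 < polyForm n α β p p := by
  refine Finset.sum_pos' (fun ν _ => mul_nonneg (by positivity) (moment_mul_self_nonneg _ _ _))
    ⟨0, by simp, ?_⟩
  have := moment_mul_self_pos hβ hn hp
  simp only [Nat.choose_zero_right, pow_zero, Module.End.one_apply]
  positivity

/-- Pascal's rule: the form of order `n + 1` arises from the weights of order `n` when the `ν`-th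
term is replaced by `c g(ν) + g(ν+1)`. -/
lemma sum_choose_pascal (n : ℕ) (c : ℝ) (g : ℕ → ℝ) :
    ∑ ν ∈ Finset.range (n + 1), (n.choose ν : ℝ) * c ^ (n - ν) * (c * g ν + g (ν + 1)) =
      ∑ ν ∈ Finset.range (n + 1 + 1), ((n + 1).choose ν : ℝ) * c ^ (n + 1 - ν) * g ν := by
  rw [Finset.sum_range_succ' (fun ν => ((n + 1).choose ν : ℝ) * c ^ (n + 1 - ν) * g ν)]
  have h1 : ∑ ν ∈ Finset.range (n + 1), (n.choose ν : ℝ) * c ^ (n - ν) * (c * g ν) =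
      ∑ ν ∈ Finset.range (n + 1), (n.choose (ν + 1) : ℝ) * c ^ (n - ν) * g (ν + 1) +
        c ^ (n + 1) * g 0 := by
    rw [Finset.sum_range_succ', Finset.sum_range_succ (fun ν => (n.choose (ν + 1) : ℝ) * _ * _)]
    simp only [Nat.choose_succ_self, Nat.cast_zero, zero_mul, add_zero]
    congr 1
    · refine Finset.sum_congr rfl fun ν hν => ?_
      have : n - ν = n - (ν + 1) + 1 := by have := Finset.mem_range.1 hν; omega
      rw [this, pow_succ]; ring
    · simp [pow_succ]; ring
  simp only [mul_add, Finset.sum_add_distrib, h1, Nat.choose_succ_succ, Nat.cast_add, add_mul]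
  simp
  ring

/-- Rests on `(ν+1) C(n,ν+1) = (n-ν) C(n,ν)`. The truncated `ν - 1` at `ν = 0` carries the factor
`0`. -/
lemma sum_choose_shift (n : ℕ) (c : ℝ) (h : ℕ → ℝ) :
    ∑ ν ∈ Finset.range (n + 1), (n.choose ν : ℝ) * c ^ (n - ν) * (ν * (c * h (ν - 1))) =
      ∑ ν ∈ Finset.range (n + 1), (n.choose ν : ℝ) * c ^ (n - ν) * ((n - ν) * h ν) := by
  rw [Finset.sum_range_succ', Finset.sum_range_succ _ n]
  simp only [Nat.cast_zero, zero_mul, mul_zero, add_zero, sub_self]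
  refine Finset.sum_congr rfl fun ν hν => ?_
  have hlt := Finset.mem_range.1 hν
  have h1 : n - ν = n - (ν + 1) + 1 := by omega
  have h2 : (n.choose (ν + 1) : ℝ) * (ν + 1) = n.choose ν * (n - ν) := by
    have := Nat.choose_succ_right_eq n ν
    rw [← Nat.cast_sub hlt.le]; exact_mod_cast this
  rw [h1, pow_succ, Nat.add_sub_cancel]
  push_cast
  linear_combination (c ^ (n - (ν + 1)) * c * h ν) * h2

/-- The Laguerre operator `β²x/4 - x∂² - (α+1)∂` on the polynomial factors. -/
noncomputable def laguerreOp (α β : ℝ) (p : ℝ[X]) : ℝ[X] :=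
  (β / 2) ^ 2 • (Polynomial.X * p) - Polynomial.X * (expDeriv β ^ 2) p - (α + 1) • expDeriv β p

lemma expDeriv_X_mul (β : ℝ) (q : ℝ[X]) :
    expDeriv β (Polynomial.X * q) = q + Polynomial.X * expDeriv β q := by
  simp only [expDeriv_apply, derivative_mul, derivative_X, mul_sub, mul_smul_comm]; ring

/-- The commutator relation `[D^ν, X] = ν D^{ν-1}`, a consequence of `[D, X] = 1`. -/
lemma expDeriv_pow_X_mul (β : ℝ) (ν : ℕ) (q : ℝ[X]) : (expDeriv β ^ ν) (Polynomial.X * q) =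
    Polynomial.X * (expDeriv β ^ ν) q + (ν : ℝ) • (expDeriv β ^ (ν - 1)) q := by
  induction ν with
  | zero => simp
  | succ ν ih =>
    rw [pow_succ', Module.End.mul_apply, ih, map_add, expDeriv_X_mul, map_smul,
      Module.End.mul_apply]
    rcases ν with _ | ν
    · simp; ring
    · simp only [Nat.add_sub_cancel, ← Module.End.mul_apply, ← pow_succ']
      push_cast
      module

/-- Commuting `D^ν` past `X` leaves the first-order coefficient `-(ν + α + 1)`. Integrating the
second-order term by parts adds `α + n + 1`, whence the factor `n - ν`. -/
lemma moment_laguerreOp (hβ : 0 < β) (hn : -1 < α + n) (ν : ℕ) (p q : ℝ[X]) :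
    moment β (α + n) ((expDeriv β ^ ν) (laguerreOp α β p) * (expDeriv β ^ ν) q) =
      ((β / 2) ^ 2 * moment β (α + n + 1) ((expDeriv β ^ ν) p * (expDeriv β ^ ν) q) +
        moment β (α + n + 1) ((expDeriv β ^ (ν + 1)) p * (expDeriv β ^ (ν + 1)) q)) +
      ((n - ν) * moment β (α + n) ((expDeriv β ^ (ν + 1)) p * (expDeriv β ^ ν) q) +
        ν * ((β / 2) ^ 2 *
          moment β (α + n) ((expDeriv β ^ (ν - 1)) p * (expDeriv β ^ (ν - 1 + 1)) q))) := by
  set c : ℝ := (β / 2) ^ 2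
  have h1 : (expDeriv β ^ ν) (laguerreOp α β p) =
      c • (Polynomial.X * (expDeriv β ^ ν) p) + (ν * c) • (expDeriv β ^ (ν - 1)) p -
        Polynomial.X * (expDeriv β ^ (ν + 2)) p - (ν + (α + 1)) • (expDeriv β ^ (ν + 1)) p := by
    have e1 : (expDeriv β ^ ν) ((expDeriv β ^ 2) p) = (expDeriv β ^ (ν + 2)) p := by
      rw [← Module.End.mul_apply, ← pow_add]
    have e2 : (ν : ℝ) • (expDeriv β ^ (ν - 1)) ((expDeriv β ^ 2) p) =
        (ν : ℝ) • (expDeriv β ^ (ν + 1)) p := by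
      rcases ν with _ | ν
      · simp
      · rw [← Module.End.mul_apply, ← pow_add]; rfl
    have e3 : (expDeriv β ^ ν) (expDeriv β p) = (expDeriv β ^ (ν + 1)) p := by
      rw [pow_succ, Module.End.mul_apply]
    rw [laguerreOp, map_sub, map_sub, map_smul, map_smul, expDeriv_pow_X_mul,
      expDeriv_pow_X_mul, e1, e2, e3]
    module
  have h2 := moment_expDeriv hβ hn ((expDeriv β ^ (ν + 1)) p) ((expDeriv β ^ ν) q)
  rw [← Module.End.mul_apply, ← Module.End.mul_apply, ← pow_succ', ← pow_succ'] at h2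
  have h3 : (ν : ℝ) * (c * moment β (α + n) ((expDeriv β ^ (ν - 1)) p * (expDeriv β ^ ν) q)) =
      ν * (c * moment β (α + n) ((expDeriv β ^ (ν - 1)) p * (expDeriv β ^ (ν - 1 + 1)) q)) := by
    rcases ν with _ | ν
    · simp
    · simp
  rw [h1, ← h3]
  simp only [sub_mul, add_mul, smul_mul_assoc, mul_assoc, moment_sub hβ hn, moment_add hβ hn,
    moment_smul, moment_X_mul]
  linear_combination -h2

/-- The point is that the right side is symmetric in `p` and `q`: `sum_choose_shift` moves the terms
with factor `ν` onto those with factor `n - ν` and so completes the symmetric pair. -/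
lemma polyForm_laguerreOp (hβ : 0 < β) (hn : -1 < α + n) (p q : ℝ[X]) :
    polyForm n α β (laguerreOp α β p) q = polyForm (n + 1) α β p q +
      ∑ ν ∈ Finset.range (n + 1), (n.choose ν : ℝ) * ((β / 2) ^ 2) ^ (n - ν) * ((n - ν) *
        (moment β (α + n) ((expDeriv β ^ (ν + 1)) p * (expDeriv β ^ ν) q) +
          moment β (α + n) ((expDeriv β ^ ν) p * (expDeriv β ^ (ν + 1)) q))) := by
  have e1 : polyForm (n + 1) α β p q = ∑ ν ∈ Finset.range (n + 1 + 1), ((n + 1).choose ν : ℝ) *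
      ((β / 2) ^ 2) ^ (n + 1 - ν) *
        moment β (α + n + 1) ((expDeriv β ^ ν) p * (expDeriv β ^ ν) q) := by
    rw [polyForm, Nat.cast_succ, ← add_assoc]
  have e2 := sum_choose_shift n ((β / 2) ^ 2)
    (fun ν => moment β (α + n) ((expDeriv β ^ ν) p * (expDeriv β ^ (ν + 1)) q))
  simp only [mul_add, Finset.sum_add_distrib]
  rw [e1, ← sum_choose_pascal n _
      (fun ν => moment β (α + n + 1) ((expDeriv β ^ ν) p * (expDeriv β ^ ν) q)), ← e2, polyForm,
    ← Finset.sum_add_distrib, ← Finset.sum_add_distrib]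
  refine Finset.sum_congr rfl fun ν _ => ?_
  rw [moment_laguerreOp hβ hn]
  ring

/-- The Laguerre operator is symmetric with respect to all the forms. -/
lemma polyForm_laguerreOp_symm (hβ : 0 < β) (hn : -1 < α + n) (p q : ℝ[X]) :
    polyForm n α β (laguerreOp α β p) q = polyForm n α β p (laguerreOp α β q) := by
  rw [polyForm_comm n α β p, polyForm_laguerreOp hβ hn, polyForm_laguerreOp hβ hn,
    polyForm_comm (n + 1)]
  congr 1
  refine Finset.sum_congr rfl fun ν _ => ?_
  rw [mul_comm ((expDeriv β ^ (ν + 1)) p), mul_comm ((expDeriv β ^ ν) p)]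
  ring

lemma moment_cross_le (hβ : 0 < β) {γ : ℝ} (hγ : -1 < γ) (t : ℝ) (p q : ℝ[X]) :
    2 * (t * moment β γ (p * q)) ≤ moment β γ (p * p) + t ^ 2 * moment β γ (q * q) := by
  have h := moment_mul_self_nonneg β γ (p - t • q)
  have e : (p - t • q) * (p - t • q) = p * p - (2 * t) • (p * q) + (t ^ 2) • (q * q) := by
    simp only [sub_mul, mul_sub, smul_mul_assoc, mul_smul_comm, mul_comm q p]; module
  rw [e, moment_add hβ hγ, moment_sub hβ hγ, moment_smul, moment_smul] at h
  linarith

/-- The cross terms are bounded by `2ab ≤ a² + b²` with parameter `β/2`; by `sum_choose_shift` the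
resulting sum is exactly `n (β/2)²` times the form, once everything has been multiplied by `β/2`. -/
lemma polyForm_laguerreOp_le (hβ : 0 < β) (hn : -1 < α + n) (p : ℝ[X]) :
    polyForm n α β (laguerreOp α β p) p ≤
      polyForm (n + 1) α β p p + n * (β / 2) * polyForm n α β p p := by
  rw [polyForm_laguerreOp hβ hn]
  refine add_le_add le_rfl ?_
  have hb : 0 < β / 2 := by positivity
  refine le_of_mul_le_mul_left ?_ hb
  set G : ℕ → ℝ := fun ν => moment β (α + n) ((expDeriv β ^ ν) p * (expDeriv β ^ ν) p)
  have h1 : n * (β / 2) ^ 2 * polyForm n α β p p =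
      ∑ ν ∈ Finset.range (n + 1), (n.choose ν : ℝ) * ((β / 2) ^ 2) ^ (n - ν) *
        ((n - ν) * (G (ν + 1) + (β / 2) ^ 2 * G ν)) := by
    have h2 := sum_choose_shift n ((β / 2) ^ 2) (fun ν => G (ν + 1))
    simp only [mul_add, Finset.sum_add_distrib]
    rw [← h2, polyForm, Finset.mul_sum, ← Finset.sum_add_distrib]
    refine Finset.sum_congr rfl fun ν _ => ?_
    have h3 : (ν : ℝ) * ((β / 2) ^ 2 * G (ν - 1 + 1)) = ν * ((β / 2) ^ 2 * G ν) := by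
      rcases ν with _ | ν
      · simp
      · simp
    rw [h3]; simp only [G]; ring
  have h4 : β / 2 * (n * (β / 2) * polyForm n α β p p) = n * (β / 2) ^ 2 * polyForm n α β p p := by
    ring
  rw [h4, h1, Finset.mul_sum]
  refine Finset.sum_le_sum fun ν hν => ?_
  have hle : (0 : ℝ) ≤ n - ν := by
    have : ν ≤ n := Nat.lt_succ_iff.1 (Finset.mem_range.1 hν)
    rw [sub_nonneg]; exact_mod_cast this
  have h5 := moment_cross_le hβ hn (β / 2) ((expDeriv β ^ (ν + 1)) p) ((expDeriv β ^ ν) p)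
  rw [mul_comm ((expDeriv β ^ ν) p) ((expDeriv β ^ (ν + 1)) p)]
  calc _ = (n.choose ν : ℝ) * ((β / 2) ^ 2) ^ (n - ν) * ((n - ν) *
        (2 * (β / 2 * moment β (α + n) ((expDeriv β ^ (ν + 1)) p * (expDeriv β ^ ν) p)))) := by ring
    _ ≤ _ := by gcongr

/-- A Hardy-type inequality: with `f = D^ν p`, integration by parts gives `(α+n+1) ∫ f² = -2 ∫ x f
f'` in the weight of order `n`, and the right side is split by `2ab ≤ a² + b²`. -/
lemma polyForm_le_succ (hβ : 0 < β) (hn : -1 < α + n) (p : ℝ[X]) :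
    β / 2 * (α + n + 1) * polyForm n α β p p ≤ polyForm (n + 1) α β p p := by
  have e : polyForm (n + 1) α β p p = ∑ ν ∈ Finset.range (n + 1 + 1), ((n + 1).choose ν : ℝ) *
      ((β / 2) ^ 2) ^ (n + 1 - ν) *
        moment β (α + n + 1) ((expDeriv β ^ ν) p * (expDeriv β ^ ν) p) := by
    rw [polyForm, Nat.cast_succ, ← add_assoc]
  rw [e, ← sum_choose_pascal n _
      (fun ν => moment β (α + n + 1) ((expDeriv β ^ ν) p * (expDeriv β ^ ν) p)),
    polyForm, Finset.mul_sum]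
  refine Finset.sum_le_sum fun ν _ => ?_
  have h1 := moment_expDeriv hβ hn ((expDeriv β ^ ν) p) ((expDeriv β ^ ν) p)
  have h2 := moment_cross_le hβ (γ := α + n + 1) (by linarith) (-(β / 2))
    (expDeriv β ((expDeriv β ^ ν) p)) ((expDeriv β ^ ν) p)
  rw [mul_comm ((expDeriv β ^ ν) p) (expDeriv β _)] at h1
  rw [← Module.End.mul_apply, ← pow_succ'] at h1 h2
  calc _ = (n.choose ν : ℝ) * ((β / 2) ^ 2) ^ (n - ν) * (β / 2 * ((α + n + 1) *
        moment β (α + n) ((expDeriv β ^ ν) p * (expDeriv β ^ ν) p))) := by ring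
    _ ≤ _ := by
      gcongr
      nlinarith [h1, h2]

end Form

/-! ### Eigenpolynomials and the spectral estimates. -/

section Eigen

variable {α β : ℝ}

/-- Conjugation by the exponential cancels the terms `β²xp/4`, so the operator does not raise the
degree. -/
lemma laguerreOp_eq (α β : ℝ) (p : ℝ[X]) : laguerreOp α β p =
    β • (Polynomial.X * derivative p) + ((α + 1) * (β / 2)) • p -
      Polynomial.X * derivative (derivative p) - (α + 1) • derivative p := by
  rw [laguerreOp, pow_two (expDeriv β), Module.End.mul_apply]
  simp only [expDeriv_apply, map_sub, derivative_smul, mul_sub, smul_sub, mul_smul_comm, smul_smul]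
  module

/-- The Laguerre operator minus its eigenvalue of index `k`. -/
noncomputable def laguerreShift (α β : ℝ) (k : ℕ) : ℝ[X] →ₗ[ℝ] ℝ[X] where
  toFun p := laguerreOp α β p - (β * (k + (α + 1) / 2)) • p
  map_add' p q := by
    simp only [laguerreOp_eq, map_add, mul_add, smul_add]; module
  map_smul' c p := by
    simp only [laguerreOp_eq, derivative_smul, mul_smul_comm, RingHom.id_apply, smul_sub, smul_add]
    module

lemma laguerreShift_X_pow (α β : ℝ) (k m : ℕ) : laguerreShift α β k (Polynomial.X ^ m) =
    (β * (m - k)) • Polynomial.X ^ m - (m * (m + α)) • Polynomial.X ^ (m - 1) := by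
  change laguerreOp α β _ - _ = _
  rw [laguerreOp_eq]
  have h1 : derivative (Polynomial.X ^ m : ℝ[X]) = (m : ℝ) • Polynomial.X ^ (m - 1) := by
    rw [derivative_X_pow, smul_eq_C_mul]
  have h2 : (m : ℝ) • (Polynomial.X * Polynomial.X ^ (m - 1) : ℝ[X]) =
      (m : ℝ) • Polynomial.X ^ m := by
    rcases m with _ | m
    · simp
    · rw [Nat.add_sub_cancel, pow_succ']
  have h3 : (m : ℝ) • (Polynomial.X * derivative (Polynomial.X ^ (m - 1)) : ℝ[X]) =
      (m * (m - 1) : ℝ) • Polynomial.X ^ (m - 1) := by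
    rcases m with _ | _ | m
    · simp
    · simp
    · rw [derivative_X_pow, ← smul_eq_C_mul, mul_smul_comm, smul_smul]
      simp only [Nat.add_sub_cancel, pow_succ']
      push_cast
      module
  rw [h1, derivative_smul, mul_smul_comm, mul_smul_comm, h2, h3]
  module

/-- Below degree `k` the shifted operator is triangular with nonzero diagonal entries `β(m - k)`, so
it can be solved from the top coefficient downwards. -/
lemma exists_laguerreShift_eq (hβ : 0 < β) (k m : ℕ) (hm : m ≤ k) (f : ℝ[X])
    (hf : ∀ i, m ≤ i → f.coeff i = 0) :
    ∃ g : ℝ[X], (∀ i, m ≤ i → g.coeff i = 0) ∧ laguerreShift α β k g = f := by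
  induction m generalizing f with
  | zero =>
    refine ⟨0, by simp, ?_⟩
    rw [map_zero]; ext i; simp [hf i (Nat.zero_le i)]
  | succ m ih =>
    have hne : β * ((m : ℝ) - k) ≠ 0 := by
      refine mul_ne_zero hβ.ne' (sub_ne_zero.2 ?_)
      exact_mod_cast (by omega : m ≠ k)
    set a : ℝ := f.coeff m / (β * ((m : ℝ) - k))
    obtain ⟨g, hg, hgf⟩ := ih (by omega) (f - laguerreShift α β k (a • Polynomial.X ^ m)) (by
      intro i hi
      rw [map_smul, laguerreShift_X_pow]
      simp only [coeff_sub, coeff_smul, coeff_X_pow, smul_eq_mul]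
      rcases hi.eq_or_lt with rfl | hlt
      · have : a * (β * ((m : ℝ) - k)) = f.coeff m := div_mul_cancel₀ _ hne
        rcases m with _ | m
        · simp only [Nat.cast_zero] at this ⊢
          simp; linarith
        · simp at this ⊢; linarith
      · rw [hf i hlt, if_neg (by omega), if_neg (by omega)]; simp)
    refine ⟨g + a • Polynomial.X ^ m, ?_, ?_⟩
    · intro i hi
      simp only [coeff_add, coeff_smul, coeff_X_pow]
      rw [hg i (by omega), if_neg (by omega)]; simp
    · rw [map_add, hgf, sub_add_cancel]

/-- The shifted operator sends `X^k` below degree `k`, where the image can be corrected. The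
diagonal entries do not involve `α`, so `α ≤ -1` is allowed. -/
lemma exists_eigenpoly (α : ℝ) (hβ : 0 < β) (k : ℕ) : ∃ p : ℝ[X], p.degree = k ∧
    laguerreOp α β p = (β * (k + (α + 1) / 2)) • p := by
  obtain ⟨g, hg, hgf⟩ := exists_laguerreShift_eq (α := α) hβ k k le_rfl
    (laguerreShift α β k (Polynomial.X ^ k)) (by
      intro i hi
      rw [laguerreShift_X_pow]
      simp only [coeff_sub, coeff_smul, coeff_X_pow, smul_eq_mul, sub_self, mul_zero, zero_mul,
        zero_sub]
      rcases k with _ | k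
      · simp
      · rw [if_neg (by omega)]; simp)
  refine ⟨Polynomial.X ^ k - g, ?_, ?_⟩
  · have hd : g.degree < k := (degree_lt_iff_coeff_zero _ _).2 hg
    rw [degree_sub_eq_left_of_degree_lt (by rwa [degree_X_pow]), degree_X_pow]
  · rw [← sub_eq_zero]
    change laguerreShift α β k (Polynomial.X ^ k - g) = 0
    rw [map_sub, hgf, sub_self]

/-- Laguerre polynomials: eigenvectors of the Laguerre operator, of every degree. -/
noncomputable def eigenSeq (α : ℝ) {β : ℝ} (hβ : 0 < β) : Polynomial.Sequence ℝ where
  elems' k := (exists_eigenpoly α hβ k).choose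
  degree_eq' k := (exists_eigenpoly α hβ k).choose_spec.1

lemma laguerreOp_eigenSeq (α : ℝ) (hβ : 0 < β) (k : ℕ) :
    laguerreOp α β (eigenSeq α hβ k) = (β * (k + (α + 1) / 2)) • eigenSeq α hβ k :=
  (exists_eigenpoly α hβ k).choose_spec.2

/-- The basis of Laguerre polynomials. -/
noncomputable def eigenBasis (α : ℝ) {β : ℝ} (hβ : 0 < β) : Module.Basis ℕ ℝ ℝ[X] :=
  (eigenSeq α hβ).basis fun i => by
    rw [isUnit_iff_ne_zero, leadingCoeff_ne_zero]; exact (eigenSeq α hβ).ne_zero i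

lemma eigenBasis_apply (α : ℝ) (hβ : 0 < β) (k : ℕ) : eigenBasis α hβ k = eigenSeq α hβ k :=
  Polynomial.Sequence.basis_eq_self (S := eigenSeq α hβ) _ k

variable {n : ℕ}

/-- Eigenvectors of a symmetric operator for distinct eigenvalues. -/
lemma polyForm_eigen_ne (hβ : 0 < β) (hn : -1 < α + n) {j k : ℕ} (h : j ≠ k) :
    polyForm n α β (eigenSeq α hβ j) (eigenSeq α hβ k) = 0 := by
  have h1 := polyForm_laguerreOp_symm hβ hn (eigenSeq α hβ j) (eigenSeq α hβ k)
  rw [laguerreOp_eigenSeq, laguerreOp_eigenSeq, polyForm_comm n α β (eigenSeq α hβ j) (_ • _),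
    polyForm_smul_left, polyForm_smul_left, polyForm_comm n α β (eigenSeq α hβ k)] at h1
  have h2 : (β * ((j : ℝ) - k)) * polyForm n α β (eigenSeq α hβ j) (eigenSeq α hβ k) = 0 := by
    linear_combination h1
  refine (mul_eq_zero.1 h2).resolve_left (mul_ne_zero hβ.ne' (sub_ne_zero.2 ?_))
  exact_mod_cast h

lemma polyForm_eigen_right (hβ : 0 < β) (hn : -1 < α + n) (p : ℝ[X]) (k : ℕ) :
    polyForm n α β p (eigenSeq α hβ k) = (eigenBasis α hβ).repr p k *
      polyForm n α β (eigenSeq α hβ k) (eigenSeq α hβ k) := by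
  have h : polyFormLin n hβ hn (eigenSeq α hβ k) =
      (polyForm n α β (eigenSeq α hβ k) (eigenSeq α hβ k)) • (eigenBasis α hβ).coord k := by
    refine (eigenBasis α hβ).ext fun j => ?_
    rw [LinearMap.smul_apply, Module.Basis.coord_apply, Module.Basis.repr_self, eigenBasis_apply]
    change polyForm n α β _ _ = _
    rcases eq_or_ne j k with rfl | hjk
    · simp
    · simp [polyForm_eigen_ne hβ hn hjk, hjk]
  have h2 := LinearMap.congr_fun h p
  rw [LinearMap.smul_apply, Module.Basis.coord_apply, smul_eq_mul, mul_comm] at h2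
  exact h2

/-- Parseval's identity. The coordinates do not depend on `n`, so forms of different orders can be
compared term by term. -/
lemma polyForm_self_eq_sum (hβ : 0 < β) (hn : -1 < α + n) (p : ℝ[X]) :
    polyForm n α β p p = ∑ k ∈ ((eigenBasis α hβ).repr p).support,
      ((eigenBasis α hβ).repr p k) ^ 2 *
        polyForm n α β (eigenSeq α hβ k) (eigenSeq α hβ k) := by
  have h := congrArg (polyFormLin n hβ hn p) ((eigenBasis α hβ).linearCombination_repr p)
  rw [Finsupp.linearCombination_apply, Finsupp.sum, map_sum] at h
  refine h.symm.trans (Finset.sum_congr rfl fun k _ => ?_)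
  rw [map_smul, eigenBasis_apply]
  change _ • polyForm n α β _ _ = _
  rw [polyForm_comm, polyForm_eigen_right hβ hn, smul_eq_mul]; ring

lemma repr_eq_zero_of_orthogonal (hβ : 0 < β) (hn : -1 < α + n) {N : ℕ} {p : ℝ[X]}
    (h : ∀ q : ℝ[X], q.natDegree ≤ N → polyForm n α β p q = 0) {k : ℕ} (hk : k ≤ N) :
    (eigenBasis α hβ).repr p k = 0 := by
  have h1 := h (eigenSeq α hβ k) (by rw [(eigenSeq α hβ).natDegree_eq]; exact hk)
  rw [polyForm_eigen_right hβ hn] at h1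
  exact (mul_eq_zero.1 h1).resolve_right (polyForm_self_pos hβ hn ((eigenSeq α hβ).ne_zero k)).ne'

lemma orthogonal_of_repr_eq_zero (hβ : 0 < β) (hn : -1 < α + n) {N : ℕ} {p : ℝ[X]}
    (h : ∀ k ≤ N, (eigenBasis α hβ).repr p k = 0) {q : ℝ[X]} (hq : q.natDegree ≤ N) :
    polyForm n α β p q = 0 := by
  have h1 : q ∈ degreeLE ℝ N := mem_degreeLE.2 (natDegree_le_iff_degree_le.1 hq)
  rw [← (eigenSeq α hβ).span_degreeLE (m := N) fun i _ => by
    rw [isUnit_iff_ne_zero, leadingCoeff_ne_zero]; exact (eigenSeq α hβ).ne_zero i] at h1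
  rw [polyForm_comm]
  have h2 : Submodule.span ℝ ((eigenSeq α hβ) '' {i | i ≤ N}) ≤
      LinearMap.ker (polyFormLin n hβ hn p) := by
    rw [Submodule.span_le]
    rintro _ ⟨k, hk, rfl⟩
    change polyForm n α β _ _ = 0
    rw [polyForm_comm, polyForm_eigen_right hβ hn, h k hk, zero_mul]
  exact h2 h1

/-- Orthogonality to the approximation space does not depend on the order of the form. -/
lemma orthogonal_of_orthogonal (hβ : 0 < β) {m : ℕ} (hn : -1 < α + n) (hm : -1 < α + m) {N : ℕ}
    {p : ℝ[X]} (h : ∀ q : ℝ[X], q.natDegree ≤ N → polyForm n α β p q = 0) {q : ℝ[X]}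
    (hq : q.natDegree ≤ N) : polyForm m α β p q = 0 :=
  orthogonal_of_repr_eq_zero hβ hm (fun _ hk => repr_eq_zero_of_orthogonal hβ hn h hk) hq

/-- For `k ≥ K` the eigenvalue minus the loss `nβ/2` from `polyForm_laguerreOp_le` is `β(k -
(n-α-1)/2) ≥ βk/2`. For the remaining `k ≤ K` the bound of `polyForm_le_succ` suffices, at the price
of the factor `1/K`. Neither constant involves `β`. -/
lemma exists_eigen_le_succ (α : ℝ) (n : ℕ) (hn : -1 < α + n) : ∃ d : ℝ, 0 < d ∧
    ∀ (β : ℝ) (hβ : 0 < β) (k : ℕ), 0 < k →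
      d * (β * k) * polyForm n α β (eigenSeq α hβ k) (eigenSeq α hβ k) ≤
        polyForm (n + 1) α β (eigenSeq α hβ k) (eigenSeq α hβ k) := by
  set K : ℝ := |n - α - 1| + 1
  have hK : 0 < K := by positivity
  have hn' : 0 < α + n + 1 := by linarith
  refine ⟨min (1 / 2) ((α + n + 1) / (2 * K)), by positivity, fun β hβ k hk => ?_⟩
  set P := polyForm n α β (eigenSeq α hβ k) (eigenSeq α hβ k)
  have hP : 0 ≤ P := polyForm_self_nonneg _ _ _ _
  rcases le_total K k with h | h
  · have h1 := polyForm_laguerreOp_le hβ hn (eigenSeq α hβ k)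
    rw [laguerreOp_eigenSeq, polyForm_smul_left] at h1
    have h2 : (1 / 2 : ℝ) * (β * k) ≤ β * (k + (α + 1) / 2) - n * (β / 2) := by
      have : (n : ℝ) - α - 1 ≤ k := by
        have := le_abs_self ((n : ℝ) - α - 1); linarith
      nlinarith
    calc _ ≤ (1 / 2 : ℝ) * (β * k) * P := by gcongr; exact min_le_left _ _
      _ ≤ (β * (k + (α + 1) / 2) - n * (β / 2)) * P := by gcongr
      _ ≤ _ := by linarith
  · refine le_trans ?_ (polyForm_le_succ hβ hn (eigenSeq α hβ k))
    calc _ ≤ ((α + n + 1) / (2 * K)) * (β * K) * P := by gcongr; exact min_le_right _ _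
      _ = _ := by field_simp; ring

lemma exists_eigen_le (α : ℝ) {s r : ℕ} (hs : -1 < α + s) (hsr : s ≤ r) : ∃ d : ℝ, 0 < d ∧
    ∀ (β : ℝ) (hβ : 0 < β) (k : ℕ), 0 < k →
      d * (β * k) ^ (r - s) * polyForm s α β (eigenSeq α hβ k) (eigenSeq α hβ k) ≤
        polyForm r α β (eigenSeq α hβ k) (eigenSeq α hβ k) := by
  induction r, hsr using Nat.le_induction with
  | base => exact ⟨1, one_pos, fun β hβ k _ => by simp⟩
  | succ r hsr ih =>
    obtain ⟨d, hd, h⟩ := ih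
    have hr : -1 < α + r := by
      have : (s : ℝ) ≤ r := by exact_mod_cast hsr
      linarith
    obtain ⟨d', hd', h'⟩ := exists_eigen_le_succ α r hr
    refine ⟨d' * d, by positivity, fun β hβ k hk => le_trans ?_ (h' β hβ k hk)⟩
    rw [Nat.succ_sub hsr, pow_succ]
    calc _ = d' * (β * k) * (d * (β * k) ^ (r - s) *
          polyForm s α β (eigenSeq α hβ k) (eigenSeq α hβ k)) := by ring
      _ ≤ _ := by gcongr; exact h β hβ k hk

/-- The estimate of a form of lower order on the orthogonal complement of the approximation
space. -/
lemma exists_polyForm_le (α : ℝ) {s r : ℕ} (hs : -1 < α + s) (hsr : s ≤ r) : ∃ d : ℝ, 0 < d ∧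
    ∀ β : ℝ, 0 < β → ∀ N : ℕ, 0 < N → ∀ p : ℝ[X],
      (∀ q : ℝ[X], q.natDegree ≤ N → polyForm r α β p q = 0) →
      d * (β * N) ^ (r - s) * polyForm s α β p p ≤ polyForm r α β p p := by
  obtain ⟨d, hd, h⟩ := exists_eigen_le α hs hsr
  have hr : -1 < α + r := by
    have : (s : ℝ) ≤ r := by exact_mod_cast hsr
    linarith
  refine ⟨d, hd, fun β hβ N hN p hp => ?_⟩
  rw [polyForm_self_eq_sum hβ hs, polyForm_self_eq_sum hβ hr, Finset.mul_sum]
  refine Finset.sum_le_sum fun k hk => ?_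
  -- Orthogonality removes the coordinates up to `N`; on the others `k` may be replaced by the
  -- smaller `N`.
  have hkN : N < k := by
    by_contra hle
    exact (Finsupp.mem_support_iff.1 hk) (repr_eq_zero_of_orthogonal hβ hr hp (not_lt.1 hle))
  have hkN' : (N : ℝ) ≤ k := by exact_mod_cast hkN.le
  have hP := polyForm_self_nonneg s α β (eigenSeq α hβ k)
  calc _ = ((eigenBasis α hβ).repr p k) ^ 2 * (d * (β * N) ^ (r - s) *
        polyForm s α β (eigenSeq α hβ k) (eigenSeq α hβ k)) := by ring
    _ ≤ ((eigenBasis α hβ).repr p k) ^ 2 * (d * (β * k) ^ (r - s) *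
        polyForm s α β (eigenSeq α hβ k) (eigenSeq α hβ k)) := by gcongr
    _ ≤ _ := by gcongr; exact h β hβ k (by omega)

/-- Forms of lower order are dominated by those of higher order. -/
lemma exists_polyForm_le_all (α : ℝ) {s r : ℕ} (hβ : 0 < β) (hs : -1 < α + s) (hsr : s ≤ r) :
    ∃ d : ℝ, 0 < d ∧ ∀ p : ℝ[X], polyForm s α β p p ≤ d * polyForm r α β p p := by
  induction r, hsr using Nat.le_induction with
  | base => exact ⟨1, one_pos, fun p => by simp⟩
  | succ r hsr ih =>
    obtain ⟨d, hd, h⟩ := ih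
    have hr : -1 < α + r := by
      have : (s : ℝ) ≤ r := by exact_mod_cast hsr
      linarith
    have hpos : 0 < β / 2 * (α + r + 1) := mul_pos (by positivity) (by linarith)
    refine ⟨d / (β / 2 * (α + r + 1)), by positivity, fun p => (h p).trans ?_⟩
    rw [div_mul_eq_mul_div, le_div_iff₀ hpos]
    have := mul_le_mul_of_nonneg_left (polyForm_le_succ hβ hr p) hd.le
    linarith

end Eigen

end Laguerre

/-! ### Density in `L²` through the moment problem. -/

namespace Laguerre

open Filter Topology Polynomial ProbabilityTheory

lemma toReal_ofReal_le_abs (a : ℝ) : |(ENNReal.ofReal a).toReal| ≤ |a| := by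
  rw [ENNReal.toReal_ofReal', abs_of_nonneg (le_max_right _ _)]
  exact max_le (le_abs_self a) (abs_nonneg a)

/-- Supplies the strip on which `complexMGF` is analytic; the positive part of `F` is dominated by
`|F|`. -/
lemma mem_interior_integrableExpSet {m : Measure ℝ} {F : ℝ → ℝ} {c : ℝ} (hF : Integrable F m)
    (hFc : Integrable (fun x => F x * Real.exp (c * |x|)) m) {t : ℝ} (ht : |t| < c) :
    t ∈ interior (integrableExpSet id (m.withDensity fun x => ENNReal.ofReal (F x))) := by
  refine mem_interior.2 ⟨Ioo (-c) c, fun s hs => ?_, isOpen_Ioo, abs_lt.1 ht⟩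
  have hs' : |s| ≤ c := abs_le.2 ⟨hs.1.le, hs.2.le⟩
  change Integrable _ _
  rw [integrable_withDensity_iff_integrable_smul₀' hF.1.aemeasurable.ennreal_ofReal
    (Eventually.of_forall fun _ => ENNReal.ofReal_lt_top)]
  refine hFc.mono (hF.1.aemeasurable.ennreal_ofReal.ennreal_toReal.aestronglyMeasurable.smul
    (by fun_prop)) (Eventually.of_forall fun x => ?_)
  simp only [smul_eq_mul, norm_mul, Real.norm_eq_abs, Real.abs_exp, id]
  have h1 : s * x ≤ c * |x| := by
    calc s * x ≤ |s * x| := le_abs_self _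
      _ = |s| * |x| := abs_mul _ _
      _ ≤ c * |x| := by gcongr
  exact mul_le_mul (toReal_ofReal_le_abs _) (Real.exp_le_exp.2 h1) (Real.exp_nonneg _)
    (abs_nonneg _)

/-- A function with exponential decay all of whose moments vanish is zero. -/
lemma ae_eq_zero_of_moments {m : Measure ℝ} [SigmaFinite m] {F : ℝ → ℝ} {c : ℝ} (hc : 0 < c)
    (hF : Integrable F m) (hFc : Integrable (fun x => F x * Real.exp (c * |x|)) m)
    (h : ∀ k : ℕ, ∫ x, F x * x ^ k ∂m = 0) : F =ᵐ[m] 0 := by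
  -- As `ENNReal.ofReal` truncates at `0`, the densities of `μp` and `μn` are the positive and the
  -- negative part of `F`. The goal is `μp = μn`.
  set μp := m.withDensity fun x => ENNReal.ofReal (F x) with hμp
  set μn := m.withDensity fun x => ENNReal.ofReal ((-F) x) with hμn
  have hnF : Integrable (-F) m := hF.neg
  have hnFc : Integrable (fun x => (-F) x * Real.exp (c * |x|)) m := by
    simpa using hFc.neg
  have : IsFiniteMeasure μp := isFiniteMeasure_withDensity_ofReal hF.2
  have : IsFiniteMeasure μn := isFiniteMeasure_withDensity_ofReal hnF.2
  have hp : ∀ {t : ℝ}, |t| < c → t ∈ interior (integrableExpSet id μp) :=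
    fun ht => mem_interior_integrableExpSet hF hFc ht
  have hn : ∀ {t : ℝ}, |t| < c → t ∈ interior (integrableExpSet id μn) :=
    fun ht => mem_interior_integrableExpSet hnF hnFc ht
  set S : Set ℂ := {z | |z.re| < c}
  have hSc : IsPreconnected S := by
    have : Convex ℝ (Complex.reLm ⁻¹' (Ioo (-c) c)) := (convex_Ioo (-c) c).linear_preimage _
    have e : S = Complex.reLm ⁻¹' (Ioo (-c) c) := by
      ext z; exact abs_lt (a := z.re) (b := c)
    rw [e]; exact this.isPreconnected
  have ap : AnalyticOnNhd ℂ (complexMGF id μp) S :=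
    fun z hz => analyticAt_complexMGF (hp hz)
  have an : AnalyticOnNhd ℂ (complexMGF id μn) S :=
    fun z hz => analyticAt_complexMGF (hn hz)
  have h0 : (0 : ℂ) ∈ S := by simpa [S] using hc
  -- The derivatives at `0` are the moments of the two measures, which differ by `∫ F x^k = 0`.
  have hmom : ∀ k, iteratedDeriv k (complexMGF id μp) 0 = iteratedDeriv k (complexMGF id μn) 0 := by
    intro k
    rw [iteratedDeriv_complexMGF (hp h0), iteratedDeriv_complexMGF (hn h0)]
    have e : ∀ {G : ℝ → ℝ}, Integrable G m →
        ∫ x, ((id x : ℝ) : ℂ) ^ k * Complex.exp (0 * (id x : ℝ))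
          ∂(m.withDensity fun x => ENNReal.ofReal (G x)) =
        ((∫ x, max (G x) 0 * x ^ k ∂m : ℝ) : ℂ) := by
      intro G hG
      rw [integral_withDensity_eq_integral_toReal_smul₀ hG.1.aemeasurable.ennreal_ofReal
        (Eventually.of_forall fun _ => ENNReal.ofReal_lt_top), ← integral_complex_ofReal]
      congr 1; ext x
      simp [ENNReal.toReal_ofReal']
    rw [e hF, e hnF]
    congr 1
    have hi : ∀ {G : ℝ → ℝ}, Integrable G m →
        (0 : ℝ) ∈ interior (integrableExpSet id (m.withDensity fun x => ENNReal.ofReal (G x))) →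
        Integrable (fun x => max (G x) 0 * x ^ k) m := by
      intro G hG hG0
      have := integrable_pow_of_mem_interior_integrableExpSet hG0 k
      rw [integrable_withDensity_iff_integrable_smul₀' hG.1.aemeasurable.ennreal_ofReal
        (Eventually.of_forall fun _ => ENNReal.ofReal_lt_top)] at this
      simpa [ENNReal.toReal_ofReal'] using this
    have hz : |(0 : ℝ)| < c := by simpa using hc
    rw [← sub_eq_zero, ← integral_sub (hi hF (hp hz)) (hi hnF (hn hz))]
    refine Eq.trans (integral_congr_ae (Eventually.of_forall fun x => ?_)) (h k)
    dsimp only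
    rw [← sub_mul]; congr 1
    simp only [Pi.neg_apply]
    rcases le_total 0 (F x) with h | h
    · rw [max_eq_left h, max_eq_right (by linarith)]; ring
    · rw [max_eq_right h, max_eq_left (by linarith)]; ring
  -- Equal Taylor series at `0`, then the identity theorem on the connected strip.
  have heq : EqOn (complexMGF id μp) (complexMGF id μn) S := by
    refine ap.eqOn_of_preconnected_of_eventuallyEq an hSc h0 ?_
    have h1 := (ap 0 h0).hasFPowerSeriesAt
    have h2 := (an 0 h0).hasFPowerSeriesAt
    simp only [← hmom] at h2
    have h3 := h1.sub h2
    rw [sub_self] at h3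
    filter_upwards [h3.eventually_eq_zero] with z hz
    exact sub_eq_zero.1 hz
  -- The strip contains the imaginary axis, where the transforms are the characteristic functions.
  have hμ : μp = μn := by
    refine Measure.ext_of_charFun ?_
    ext t
    rw [← complexMGF_id_mul_I, ← complexMGF_id_mul_I]
    exact heq (by simpa [S] using hc)
  have hd := (withDensity_eq_iff hF.1.aemeasurable.ennreal_ofReal
    hnF.1.aemeasurable.ennreal_ofReal (by
      have := hF.lintegral_lt_top
      exact this.ne)).1 hμ
  filter_upwards [hd] with x hx
  have hx' := congrArg ENNReal.toReal hx
  simp only [ENNReal.toReal_ofReal', Pi.neg_apply] at hx'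
  rcases le_total 0 (F x) with h | h
  · rw [max_eq_left h, max_eq_right (by linarith)] at hx'; exact hx'
  · rw [max_eq_right h, max_eq_left (by linarith)] at hx'; simp; linarith

/-- The embedding of the approximation spaces in `L²(0, ∞)`. -/
noncomputable def expPolyL2 {β γ : ℝ} (hβ : 0 < β) (hγ : -1 < γ) : ℝ[X] →ₗ[ℝ] Lp ℝ 2 halfVol where
  toFun p := toL2 γ (expPoly β p)
  map_add' p q := by
    rw [expPoly_add, toL2_add (memL2_expPoly hβ hγ p) (memL2_expPoly hβ hγ q)]
  map_smul' c p := by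
    rw [expPoly_smul, toL2_smul (memL2_expPoly hβ hγ p)]; rfl

/-- The functions `e^{-βx/2} p(x)` are dense in the weighted space. -/
lemma dense_expPolyL2 {β γ : ℝ} (hβ : 0 < β) (hγ : -1 < γ) (f : Lp ℝ 2 halfVol) :
    f ∈ (LinearMap.range (expPolyL2 hβ hγ)).topologicalClosure := by
  suffices h : (LinearMap.range (expPolyL2 hβ hγ)).topologicalClosure = ⊤ by rw [h]; trivial
  rw [Submodule.topologicalClosure_eq_top_iff, Submodule.eq_bot_iff]
  intro g hg
  rw [Submodule.mem_orthogonal] at hg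
  obtain ⟨v, hv, rfl⟩ := exists_toL2_eq γ g
  have hort : ∀ p : ℝ[X], ∫ x, expPoly β p x * v x * x ^ γ ∂halfVol = 0 := by
    intro p
    have := hg _ ⟨p, rfl⟩
    change inner ℝ (toL2 γ (expPoly β p)) _ = 0 at this
    rwa [inner_toL2 (memL2_expPoly hβ hγ p) hv] at this
  set F : ℝ → ℝ := fun x => v x * x ^ γ * Real.exp (-(β * x / 2))
  have hexp : ∀ {b : ℝ}, 0 < b → Integrable (fun x => expPoly b 1 x * v x * x ^ γ) halfVol :=
    fun hb => integrable_mul_of_memL2 (memL2_expPoly hb hγ 1) hv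
  have hF : Integrable F halfVol := (hexp hβ).congr (Eventually.of_forall fun x => by
    simp only [expPoly, eval_one, F]; ring)
  -- Half of the decay `e^{-βx/2}` is spent on the exponential moment; the other half, `e^{-βx/4}`,
  -- still lies in the weighted space.
  have hFc : Integrable (fun x => F x * Real.exp (β / 4 * |x|)) halfVol := by
    refine (hexp (b := β / 2) (by positivity)).congr ?_
    filter_upwards [ae_pos] with x hx
    simp only [expPoly, eval_one, F]
    have : Real.exp (-(β / 2 * x / 2)) = Real.exp (-(β * x / 2)) * Real.exp (β / 4 * |x|) := by
      rw [← Real.exp_add, abs_of_pos hx]; congr 1; ring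
    rw [this]; ring
  have h0 : F =ᵐ[halfVol] 0 := by
    refine ae_eq_zero_of_moments (c := β / 4) (by positivity) hF hFc fun k => ?_
    rw [← hort (Polynomial.X ^ k)]
    congr 1; ext x
    simp only [expPoly, eval_pow, eval_X, F]; ring
  have hv0 : v =ᵐ[halfVol] (0 : ℝ) • v := by
    filter_upwards [h0, ae_pos] with x hx hx0
    have h1 : Real.exp (-(β * x / 2)) ≠ 0 := Real.exp_ne_zero _
    have h2 : x ^ γ ≠ 0 := (Real.rpow_pos_of_pos hx0 _).ne'
    simpa [F, h1, h2] using hx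
  rw [(toL2_eq_iff hv (hv.smul 0)).2 hv0, toL2_smul hv, zero_smul]

end Laguerre

/-! ### Density in the Sobolev spaces through the operator `∂ - β/2`. -/

namespace Laguerre

open Filter Topology Polynomial

lemma IsTest.exists_Icc {φ : ℝ → ℝ} (h : IsTest φ) :
    ∃ a b : ℝ, 0 < a ∧ a ≤ b ∧ Function.support φ ⊆ Ioc a b := by
  obtain ⟨B, hB⟩ := h.compact.isBounded.bddAbove
  rcases (tsupport φ).eq_empty_or_nonempty with he | hne
  · refine ⟨1, 1, one_pos, le_rfl, (subset_tsupport φ).trans ?_⟩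
    rw [he]; exact empty_subset _
  · obtain ⟨a, ha, hmin⟩ := h.compact.exists_isMinOn hne continuousOn_id
    have ha0 : 0 < a := h.support ha
    have haB : a ≤ B := hB ha
    refine ⟨a / 2, B, by positivity, by linarith, fun x hx => ?_⟩
    have hx' := subset_tsupport φ hx
    have h1 : a ≤ x := hmin hx'
    exact ⟨by linarith, hB hx'⟩

/-- A test function of vanishing integral is the derivative of a test function. -/
lemma IsTest.exists_primitive {χ : ℝ → ℝ} (h : IsTest χ) (h0 : ∫ x, χ x = 0) :
    ∃ Φ, IsTest Φ ∧ ∀ x, HasDerivAt Φ (χ x) x := by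
  obtain ⟨a, b, ha, hab, hs⟩ := h.exists_Icc
  have hd : ∀ x, HasDerivAt (fun x => ∫ t in a..x, χ t) (χ x) x := fun x =>
    intervalIntegral.integral_hasDerivAt_right (h.contDiff.continuous.intervalIntegrable _ _)
      (h.contDiff.continuous.stronglyMeasurableAtFilter _ _) h.contDiff.continuous.continuousAt
  have hz : ∀ x, x ∉ Icc a b → ∫ t in a..x, χ t = 0 := by
    intro x hx
    rcases le_or_gt x a with hxa | hxa
    · rw [intervalIntegral.integral_symm, intervalIntegral.integral_congr (g := fun _ => (0 : ℝ))]
      · simp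
      · intro t ht
        rw [uIcc_of_le hxa] at ht
        by_contra hne
        exact absurd (hs hne).1 (not_lt.2 ht.2)
    · have hbx : b < x := by
        by_contra hle; exact hx ⟨hxa.le, not_lt.1 hle⟩
      -- To the right of the support the primitive equals the total integral, which vanishes by
      -- assumption.
      rw [intervalIntegral.integral_eq_integral_of_support_subset
        (hs.trans (Ioc_subset_Ioc_right hbx.le)), h0]
  refine ⟨fun x => ∫ t in a..x, χ t, ⟨?_, HasCompactSupport.intro isCompact_Icc hz, ?_⟩, hd⟩
  · rw [contDiff_infty_iff_deriv]
    refine ⟨fun x => (hd x).differentiableAt, ?_⟩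
    rw [funext fun x => (hd x).deriv]
    exact h.contDiff
  · refine (closure_minimal ?_ isClosed_Icc).trans (fun x hx => ha.trans_le hx.1 : Icc a b ⊆ Ioi 0)
    intro x hx
    by_contra hne
    exact hx (hz x hne)

lemma exists_test (b : ℝ) : ∃ ψ, IsTest ψ ∧ ∫ x, ψ x * Real.exp (b * x) = 1 := by
  let f : ContDiffBump (2 : ℝ) := ⟨1 / 2, 1, by norm_num, by norm_num⟩
  have hf : IsTest (f.normed volume) := by
    refine ⟨f.contDiff_normed, f.hasCompactSupport_normed, ?_⟩
    rw [f.tsupport_normed_eq]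
    intro x hx
    rw [Metric.mem_closedBall, Real.dist_eq] at hx
    have h1 : |x - 2| ≤ 1 := hx
    have := (abs_le.1 h1).1
    change 0 < x
    linarith
  refine ⟨_, hf.mul_smooth (f := fun x => Real.exp (-(b * x))) (by fun_prop), ?_⟩
  rw [← f.integral_normed (μ := volume)]
  congr 1; ext x
  rw [mul_assoc, ← Real.exp_add]; simp

/-- The weak solutions of `z' = b z` are exponentials. -/
lemma ae_eq_exp_of_isWeakDeriv {z : ℝ → ℝ} {b : ℝ} (h : IsWeakDeriv 1 z (b • z)) :
    ∃ C : ℝ, z =ᵐ[halfVol] fun x => C * Real.exp (b * x) := by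
  obtain ⟨ψ₀, hψ₀, h₀⟩ := exists_test b
  rw [isWeakDeriv_iff] at h
  have hexp : ContDiff ℝ ∞ fun x => Real.exp (b * x) := by fun_prop
  have hexp' : ContDiff ℝ ∞ fun x => Real.exp (-(b * x)) := by fun_prop
  have hint : ∀ {ψ : ℝ → ℝ}, IsTest ψ → Integrable (fun x => ψ x * Real.exp (b * x)) := fun hψ =>
    ((hψ.mul_smooth hexp).contDiff.continuous).integrable_of_hasCompactSupport
      (hψ.mul_smooth hexp).compact
  refine ⟨∫ x, z x * ψ₀ x ∂halfVol, ae_eq_of_forall_test h.1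
    ((by fun_prop : Continuous fun x => (∫ x, z x * ψ₀ x ∂halfVol) * Real.exp
      (b * x)).locallyIntegrable.locallyIntegrableOn _) fun ψ hψ => ?_⟩
  set c : ℝ := ∫ x, ψ x * Real.exp (b * x)
  -- Subtracting `c ψ₀` makes the integral against `e^{bx}` vanish, so that `(ψ - c ψ₀) e^{bx} =
  -- Φ'`. Then `φ = Φ e^{-bx}` is a test function with `φ' + b φ = ψ - c ψ₀`, and the equation for
  -- `z` gives `∫ z ψ = c ∫ z ψ₀`.
  have hψ₁ : IsTest (ψ - c • ψ₀) := hψ.sub (hψ₀.smul c)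
  obtain ⟨Φ, hΦ, hd⟩ := (hψ₁.mul_smooth hexp).exists_primitive (by
    have e : (fun x => (ψ - c • ψ₀) x * Real.exp (b * x)) = fun x =>
        ψ x * Real.exp (b * x) - c * (ψ₀ x * Real.exp (b * x)) := by
      ext x; simp; ring
    rw [e, integral_sub (hint hψ) ((hint hψ₀).const_mul c), integral_const_mul, h₀, mul_one,
      sub_self])
  have hφ := hΦ.mul_smooth hexp'
  have h1 := h.2.2 _ hφ
  have hder : ∀ x, deriv (fun x => Φ x * Real.exp (-(b * x))) x =
      ψ x - c * ψ₀ x - b * (Φ x * Real.exp (-(b * x))) := by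
    intro x
    have h2 : HasDerivAt (fun x : ℝ => Real.exp (-(b * x))) (Real.exp (-(b * x)) * -b) x := by
      have : HasDerivAt (fun x : ℝ => -(b * x)) (-b) x := by
        simpa using ((hasDerivAt_id x).const_mul b).fun_neg
      exact this.exp
    have h4 : Real.exp (b * x) * Real.exp (-(b * x)) = 1 := by rw [← Real.exp_add]; simp
    rw [((hd x).fun_mul h2).deriv]
    simp only [Pi.sub_apply, Pi.smul_apply, smul_eq_mul]
    linear_combination (ψ x - c * ψ₀ x) * h4
  have i1 := integrable_mul_test h.1 hψ
  have i2 := (integrable_mul_test h.1 hψ₀).const_mul c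
  have i3 := (integrable_mul_test h.1 hφ).const_mul b
  have e1 : ∫ x, z x * iteratedDeriv 1 (fun x => Φ x * Real.exp (-(b * x))) x ∂halfVol =
      ∫ x, z x * ψ x ∂halfVol - c * ∫ x, z x * ψ₀ x ∂halfVol -
        b * ∫ x, z x * (Φ x * Real.exp (-(b * x))) ∂halfVol := by
    rw [← integral_const_mul, ← integral_const_mul, ← integral_sub i1 i2]
    refine Eq.trans ?_ (integral_sub (i1.sub i2) i3)
    congr 1; ext x
    rw [iteratedDeriv_one, hder]; ring
  have e2 : ∫ x, (b • z) x * (Φ x * Real.exp (-(b * x))) ∂halfVol =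
      b * ∫ x, z x * (Φ x * Real.exp (-(b * x))) ∂halfVol := by
    rw [← integral_const_mul]
    congr 1; ext x
    simp only [Pi.smul_apply, smul_eq_mul]; ring
  rw [e1, e2] at h1
  have e3 : ∫ x, (∫ x, z x * ψ₀ x ∂halfVol) * Real.exp (b * x) * ψ x ∂halfVol =
      (∫ x, z x * ψ₀ x ∂halfVol) * c := by
    have ec : c = ∫ x, ψ x * Real.exp (b * x) ∂halfVol := by
      refine (setIntegral_eq_integral_of_forall_compl_eq_zero fun x hx => ?_).symm
      have : ψ x = 0 := by
        by_contra h5; exact hx (hψ.support (subset_tsupport _ h5))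
      simp [this]
    rw [ec, ← integral_const_mul]
    congr 1; ext x; ring
  rw [e3]
  linarith

/-- The equation `z' = b z` with `b > 0` has no nonzero weak solution in the weighted space. -/
lemma ae_eq_zero_of_isWeakDeriv {γ b : ℝ} (hγ : -1 < γ) (hb : 0 < b) {z : ℝ → ℝ}
    (hz : MemL2 (powWeight γ) z) (h : IsWeakDeriv 1 z (b • z)) : z =ᵐ[halfVol] 0 := by
  obtain ⟨C, hC⟩ := ae_eq_exp_of_isWeakDeriv h
  suffices hC0 : C = 0 by
    filter_upwards [hC] with x hx; simp [hx, hC0]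
  by_contra hne
  have h1 : IntegrableOn (fun x => z x ^ 2 * powWeight γ x) (Ioi 1) volume :=
    hz.2.mono_set (Ioi_subset_Ioi zero_le_one)
  have hC1 : ∀ᵐ x ∂(volume.restrict (Ioi (1 : ℝ))), z x = C * Real.exp (b * x) :=
    ae_restrict_of_ae_restrict_of_subset (Ioi_subset_Ioi zero_le_one) hC
  -- On `(1, ∞)` one has `z² x^γ ≥ C² e^{2bx} x^{-1} ≥ 2bC²`, a constant that is not integrable
  -- unless `C = 0`.
  have h2 : IntegrableOn (fun _ : ℝ => C ^ 2 * (2 * b)) (Ioi 1) volume := by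
    refine Integrable.mono h1 (by fun_prop) ?_
    filter_upwards [hC1, ae_restrict_mem measurableSet_Ioi] with x hx hx1
    have hx1' : (1 : ℝ) < x := hx1
    have hx0 : 0 < x := by linarith
    have h3 : x ^ (-1 : ℝ) ≤ x ^ γ := Real.rpow_le_rpow_of_exponent_le hx1'.le hγ.le
    have h4 : 2 * b * x ≤ Real.exp (2 * b * x) := by
      have := Real.add_one_le_exp (2 * b * x); linarith
    have h5 : Real.exp (b * x) ^ 2 = Real.exp (2 * b * x) := by
      rw [← Real.exp_nat_mul]; congr 1; push_cast; ring
    rw [hx, Real.norm_of_nonneg (by positivity), powWeight,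
      Real.norm_of_nonneg (by positivity), mul_pow, h5, mul_assoc]
    refine mul_le_mul_of_nonneg_left ?_ (sq_nonneg C)
    calc 2 * b = 2 * b * x * x ^ (-1 : ℝ) := by
          rw [Real.rpow_neg_one]; field_simp
      _ ≤ _ := by gcongr
  rw [integrableOn_const_iff] at h2
  rcases h2 with h2 | h2
  · have : C ^ 2 * (2 * b) ≠ 0 := by positivity
    exact this (enorm_eq_zero.1 h2)
  · simp at h2

/-- The operator `∂ - β/2` on the polynomial factors. -/
noncomputable def expShift (β : ℝ) : ℝ[X] →ₗ[ℝ] ℝ[X] :=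
  expDeriv β - (β / 2) • LinearMap.id

lemma expShift_apply (β : ℝ) (p : ℝ[X]) : expShift β p = expDeriv β p - (β / 2) • p := rfl

lemma expShift_surjective {β : ℝ} (hβ : 0 < β) : Function.Surjective (expShift β) := by
  rw [← LinearMap.range_eq_top, eq_top_iff]
  have key : ∀ k : ℕ, (Polynomial.X ^ k : ℝ[X]) ∈ LinearMap.range (expShift β) := by
    -- The operator sends `X^k` to `k X^{k-1} - β X^k`; this is solved for `X^k` and used
    -- recursively.
    have e : ∀ k : ℕ, (Polynomial.X ^ k : ℝ[X]) = expShift β (-(1 / β) • Polynomial.X ^ k) +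
        (k / β : ℝ) • Polynomial.X ^ (k - 1) := by
      intro k
      simp only [map_smul, expShift_apply, expDeriv_apply]
      rw [derivative_X_pow, ← smul_eq_C_mul, smul_sub, smul_sub, smul_smul, smul_smul]
      have : -(1 / β) * (β / 2) = -(1 / 2) := by field_simp
      rw [this]
      module
    intro k
    induction k with
    | zero => rw [e]; refine Submodule.add_mem _ ⟨_, rfl⟩ (by simp)
    | succ k ih =>
      rw [e]
      exact Submodule.add_mem _ ⟨_, rfl⟩ (Submodule.smul_mem _ _ ih)
  intro p _
  induction p using Polynomial.induction_on' with
  | add p q hp hq => exact Submodule.add_mem _ (hp trivial) (hq trivial)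
  | monomial k a =>
    rw [← C_mul_X_pow_eq_monomial, ← smul_eq_C_mul]
    exact Submodule.smul_mem _ _ (key k)

lemma integrable_poly_mul_bdd {β γ : ℝ} (hβ : 0 < β) (hγ : -1 < γ) (p : ℝ[X]) {ψ : ℝ → ℝ}
    (hψ : Measurable ψ) {C : ℝ} (hC : ∀ x, 0 < x → |ψ x| ≤ C) :
    Integrable (fun x => p.eval x * Real.exp (-(β * x)) * x ^ γ * ψ x) halfVol := by
  refine (((integrable_poly hβ hγ p).norm.mul_const C)).mono'
    ((integrable_poly hβ hγ p).1.mul hψ.aestronglyMeasurable) ?_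
  filter_upwards [ae_pos] with x hx
  rw [norm_mul]
  gcongr
  exact hC x hx

/-- The operator `∂ - β/2` is bounded below in the weighted space. -/
lemma exists_moment_le {β γ : ℝ} (hβ : 0 < β) (hγ : -1 < γ) : ∃ C : ℝ, 0 < C ∧ ∀ p : ℝ[X],
    moment β γ (p * p) ≤ C * moment β γ (expShift β p * expShift β p) := by
  have hγ1 : 0 < γ + 1 := by linarith
  set c : ℝ := min β (β * (γ + 1) / 2)
  have hc : 0 < c := by positivity
  have hcβ : c ≤ β := min_le_left _ _
  have hcγ : c ≤ β * (γ + 1) / 2 := min_le_right _ _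
  refine ⟨4 / c ^ 2, by positivity, fun p => ?_⟩
  -- The energy identity uses the multiplier `x/(x+K)`: it is bounded, and its zero at `0` removes
  -- the boundary term for every `γ > -1`. The choice `Kβ = 1` cancels the negative term of `ψ₂ + β
  -- ψ₁`.
  set K : ℝ := 1 / β
  have hK : 0 < K := by positivity
  have hKβ : K * β = 1 := by simp only [K]; field_simp
  set ψ₁ : ℝ → ℝ := fun x => x / (x + K)
  set ψ₂ : ℝ → ℝ := fun x => (γ + 1) / (x + K) - x / (x + K) ^ 2
  have m1 : Measurable ψ₁ := by fun_prop
  have m2 : Measurable ψ₂ := by fun_prop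
  have b1 : ∀ x, 0 < x → |ψ₁ x| ≤ 1 := fun x hx => by
    have : 0 < x + K := by positivity
    rw [abs_of_nonneg (by positivity), div_le_one this]; linarith
  have b2 : ∀ x, 0 < x → |ψ₂ x| ≤ (γ + 1) / K + 1 / K := fun x hx => by
    have h0 : 0 < x + K := by positivity
    refine (abs_sub _ _).trans ?_
    rw [abs_of_nonneg (by positivity), abs_of_nonneg (by positivity)]
    refine add_le_add (by gcongr; linarith) ?_
    rw [div_le_div_iff₀ (by positivity) hK]; nlinarith
  set q := expDeriv β p
  set g := expShift β p
  have hqg : ∀ x, q.eval x = g.eval x + β / 2 * p.eval x := by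
    intro x
    simp only [g, q, expShift_apply, eval_sub, eval_smul, smul_eq_mul]; ring
  set G : ℝ → ℝ := fun x => expPoly β p x ^ 2 * (x ^ (γ + 1) / (x + K))
  set G' : ℝ → ℝ := fun x => (C 2 * p * q).eval x * Real.exp (-(β * x)) * x ^ γ * ψ₁ x +
    (p * p).eval x * Real.exp (-(β * x)) * x ^ γ * ψ₂ x
  have hexp : ∀ x : ℝ, Real.exp (-(β * x)) = Real.exp (-(β * x / 2)) * Real.exp (-(β * x / 2)) := by
    intro x; rw [← Real.exp_add]; congr 1; ring
  have hG'i : Integrable G' halfVol :=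
    (integrable_poly_mul_bdd hβ hγ _ m1 b1).add (integrable_poly_mul_bdd hβ hγ _ m2 b2)
  have hGi : Integrable G halfVol := by
    refine (integrable_poly_mul_bdd hβ hγ (p * p) m1 b1).congr ?_
    filter_upwards [ae_pos] with x hx
    simp only [G, ψ₁, expPoly, eval_mul, hexp, Real.rpow_add_one hx.ne']; ring
  have hder : ∀ x ∈ Ioi (0 : ℝ), HasDerivAt G (G' x) x := by
    intro x hx
    have hx0 : (0 : ℝ) < x := hx
    have hxK : x + K ≠ 0 := by positivity
    have h1 := (hasDerivAt_expPoly β p x).pow 2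
    have h2 := (Real.hasDerivAt_rpow_const (p := γ + 1) (Or.inl hx0.ne'))
    have h3 := h1.mul (h2.div ((hasDerivAt_id x).add_const K) hxK)
    refine h3.congr_deriv ?_
    simp only [G', ψ₁, ψ₂, expPoly, eval_mul, eval_C, hexp, Real.rpow_add_one hx0.ne',
      add_sub_cancel_right, q, Pi.pow_apply, Pi.div_apply, id]
    field_simp
    ring
  have hlim : Tendsto G atTop (𝓝 0) :=
    tendsto_zero_of_hasDerivAt_of_integrableOn_Ioi hder hG'i hGi
  have hcont : ContinuousWithinAt G (Ici 0) 0 := by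
    refine ContinuousAt.continuousWithinAt ?_
    refine ((contDiff_expPoly β p).continuous.continuousAt.pow 2).mul ?_
    refine (Real.continuousAt_rpow_const _ _ (Or.inr hγ1.le)).div
      (continuousAt_id.add continuousAt_const) ?_
    simpa using hK.ne'
  have hint := integral_Ioi_of_hasDerivAt_of_tendsto hcont hder hG'i hlim
  have hG0 : G 0 = 0 := by simp [G, Real.zero_rpow hγ1.ne']
  rw [hG0, sub_zero] at hint
  -- The integral of `G'` is zero. Substituting `q = g + (β/2) p` gives the integrand `2pgψ₁ + (ψ₂ +
  -- βψ₁)p²`, where `ψ₂ + βψ₁ ≥ c` and the mixed term costs half of `c p²`; this yields the constant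
  -- `4/c²`.
  have hle : ∫ x, (c / 2 * ((p * p).eval x * Real.exp (-(β * x)) * x ^ γ) -
      2 / c * ((g * g).eval x * Real.exp (-(β * x)) * x ^ γ)) ∂halfVol ≤ ∫ x, G' x ∂halfVol := by
    refine integral_mono_ae (((integrable_poly hβ hγ (p * p)).const_mul _).sub
      ((integrable_poly hβ hγ (g * g)).const_mul _)) hG'i ?_
    filter_upwards [ae_pos] with x hx
    have hxK : 0 < x + K := by positivity
    simp only [G', eval_mul, eval_C, hqg]
    have hw : 0 ≤ Real.exp (-(β * x)) * x ^ γ := by positivity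
    set P := p.eval x
    set Q := g.eval x
    have e1 : c ≤ ψ₂ x + β * ψ₁ x := by
      have : ψ₂ x + β * ψ₁ x = (β * x ^ 2 + (γ + 1) * x + (γ + 1) * K) / (x + K) ^ 2 := by
        simp only [ψ₁, ψ₂]
        field_simp
        linear_combination x * hKβ
      rw [this, le_div_iff₀ (by positivity)]
      have t1 : c * x ^ 2 ≤ β * x ^ 2 := by gcongr
      have t2 : c * (2 * K) ≤ γ + 1 := by
        calc c * (2 * K) ≤ β * (γ + 1) / 2 * (2 * K) := by gcongr
          _ = (γ + 1) * (K * β) := by ring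
          _ = _ := by rw [hKβ, mul_one]
      nlinarith [mul_le_mul_of_nonneg_right t2 hx.le, mul_le_mul_of_nonneg_right t2 hK.le,
        mul_pos hc (mul_pos hK hK)]
    have e2 : |ψ₁ x| ≤ 1 := b1 x hx
    have e3 : c / 2 * P ^ 2 - 2 / c * Q ^ 2 ≤ 2 * P * Q * ψ₁ x + (ψ₂ x + β * ψ₁ x) * P ^ 2 := by
      have t1 : -(2 * |P| * |Q|) ≤ 2 * P * Q * ψ₁ x := by
        have : |2 * P * Q * ψ₁ x| ≤ 2 * |P| * |Q| := by
          rw [abs_mul, abs_mul, abs_mul, abs_two]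
          exact mul_le_of_le_one_right (by positivity) e2
        exact (abs_le.1 this).1
      have t2 : 2 * |P| * |Q| ≤ c / 2 * P ^ 2 + 2 / c * Q ^ 2 := by
        have h3 : 0 ≤ (c * |P| - 2 * |Q|) ^ 2 / (2 * c) := by positivity
        have h4 : (c * |P| - 2 * |Q|) ^ 2 / (2 * c) =
            c / 2 * P ^ 2 + 2 / c * Q ^ 2 - 2 * |P| * |Q| := by
          rw [← sq_abs P, ← sq_abs Q]; field_simp; ring
        linarith
      have t3 : c * P ^ 2 ≤ (ψ₂ x + β * ψ₁ x) * P ^ 2 := by gcongr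
      linarith
    calc _ = (c / 2 * P ^ 2 - 2 / c * Q ^ 2) * (Real.exp (-(β * x)) * x ^ γ) := by ring
      _ ≤ (2 * P * Q * ψ₁ x + (ψ₂ x + β * ψ₁ x) * P ^ 2) * (Real.exp (-(β * x)) * x ^ γ) := by
        gcongr
      _ = _ := by ring
  rw [hint, integral_sub ((integrable_poly hβ hγ (p * p)).const_mul _)
    ((integrable_poly hβ hγ (g * g)).const_mul _), integral_const_mul, integral_const_mul] at hle
  change c / 2 * moment β γ (p * p) - 2 / c * moment β γ (g * g) ≤ 0 at hle
  have h5 : c / 2 * moment β γ (p * p) ≤ 2 / c * moment β γ (g * g) := by linarith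
  calc moment β γ (p * p) = 2 / c * (c / 2 * moment β γ (p * p)) := by field_simp
    _ ≤ 2 / c * (2 / c * moment β γ (g * g)) := by gcongr
    _ = _ := by field_simp; ring

lemma norm_sq_expPolyL2 {β γ : ℝ} (hβ : 0 < β) (hγ : -1 < γ) (p : ℝ[X]) :
    ‖expPolyL2 hβ hγ p‖ ^ 2 = moment β γ (p * p) := by
  rw [← real_inner_self_eq_norm_sq]
  change inner ℝ (toL2 γ (expPoly β p)) (toL2 γ (expPoly β p)) = _
  rw [inner_toL2 (memL2_expPoly hβ hγ p) (memL2_expPoly hβ hγ p), innerL2_expPoly]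

lemma cauchySeq_of_dist_le {E F : Type*} [PseudoMetricSpace E] [PseudoMetricSpace F]
    {f : ℕ → E} {g : ℕ → F} {C : ℝ} (h : ∀ i j, dist (f i) (f j) ≤ C * dist (g i) (g j))
    (hg : CauchySeq g) : CauchySeq f := by
  rw [cauchySeq_iff_tendsto_dist_atTop_0] at hg ⊢
  refine squeeze_zero (fun _ => dist_nonneg) (fun n => h n.1 n.2) ?_
  simpa using hg.const_mul C

lemma expPolyL2_bounded_below {β γ : ℝ} (hβ : 0 < β) (hγ : -1 < γ) : ∃ C : ℝ, ∀ p : ℝ[X],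
    ‖expPolyL2 hβ hγ p‖ ≤ C * ‖expPolyL2 hβ hγ (expShift β p)‖ := by
  obtain ⟨C, hC, h⟩ := exists_moment_le hβ hγ
  refine ⟨Real.sqrt C, fun p => ?_⟩
  refine abs_le_of_sq_le_sq' ?_ (by positivity) |>.2
  rw [mul_pow, Real.sq_sqrt hC.le, norm_sq_expPolyL2, norm_sq_expPolyL2]
  exact h p

/-- Density of the approximation spaces in the weighted Sobolev spaces: the derivatives converge
simultaneously. -/
lemma exists_approx {β γ : ℝ} (hβ : 0 < β) (hγ : -1 < γ) (r : ℕ) (v : ℕ → ℝ → ℝ)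
    (hv : ∀ k ≤ r, MemL2 (powWeight γ) (v k)) (hd : ∀ k < r, IsWeakDeriv 1 (v k) (v (k + 1))) :
    ∃ p : ℕ → ℝ[X], ∀ k ≤ r, Tendsto (fun j => expPolyL2 hβ hγ ((expDeriv β ^ k) (p j))) atTop
      (𝓝 (toL2 γ (v k))) := by
  induction r generalizing v with
  | zero =>
    have h := dense_expPolyL2 hβ hγ (toL2 γ (v 0))
    obtain ⟨x, hx, hlim⟩ := mem_closure_iff_seq_limit.1 h
    choose p hp using hx
    refine ⟨p, fun k hk => ?_⟩
    obtain rfl : k = 0 := by omega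
    simpa [hp] using hlim
  | succ r ih =>
    -- The induction hypothesis approximates `(∂ - β/2) v`. Solving `expShift p = q` recovers
    -- approximants of `v` itself, Cauchy because the operator is bounded below.
    obtain ⟨q, hq⟩ := ih (fun k => v (k + 1) - (β / 2) • v k)
      (fun k hk => (hv _ (by omega)).sub ((hv _ (by omega)).smul _))
      (fun k hk => (hd _ (by omega)).sub ((hd _ (by omega)).smul _))
    choose p hp using fun j => expShift_surjective hβ (q j)
    have hrec : ∀ k j, (expDeriv β ^ (k + 1)) (p j) =
        (expDeriv β ^ k) (q j) + (β / 2) • (expDeriv β ^ k) (p j) := by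
      intro k j
      rw [← hp, expShift_apply, map_sub, map_smul, pow_succ, Module.End.mul_apply]; module
    obtain ⟨C, hC⟩ := expPolyL2_bounded_below hβ hγ
    have hcau : CauchySeq fun j => expPolyL2 hβ hγ (p j) := by
      refine cauchySeq_of_dist_le (C := C) (g := fun j => expPolyL2 hβ hγ (q j)) (fun i j => ?_) ?_
      · rw [dist_eq_norm, dist_eq_norm, ← map_sub, ← map_sub, ← hp, ← hp, ← map_sub]
        exact hC _
      · have := (hq 0 (Nat.zero_le _)).cauchySeq
        simpa using this
    obtain ⟨L, hL⟩ := cauchySeq_tendsto_of_complete hcau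
    obtain ⟨y, hy, rfl⟩ := exists_toL2_eq γ L
    have hv0 := hv 0 (by omega)
    have hv1 := hv 1 (by omega)
    have hw0 : MemL2 (powWeight γ) (v 1 - (β / 2) • v 0) := hv1.sub (hv0.smul _)
    have hy1 : MemL2 (powWeight γ) (v 1 - (β / 2) • v 0 + (β / 2) • y) := hw0.add (hy.smul _)
    have hyd : IsWeakDeriv 1 y (v 1 - (β / 2) • v 0 + (β / 2) • y) := by
      refine isWeakDeriv_of_tendsto (γ := γ) (γ' := γ) (v := fun j => expPoly β (p j))
        (w := fun j => expPoly β ((expDeriv β ^ 1) (p j))) (fun j => memL2_expPoly hβ hγ _) hy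
        (fun j => memL2_expPoly hβ hγ _) hy1 (fun j => isWeakDeriv_expPoly β (p j) 1) hL ?_
      change Tendsto (fun j => expPolyL2 hβ hγ ((expDeriv β ^ 1) (p j))) _ _
      rw [toL2_add hw0 (hy.smul _), toL2_smul hy]
      have h0 := hq 0 (Nat.zero_le _)
      simp only [pow_zero, Module.End.one_apply, zero_add] at h0
      refine (h0.add (hL.const_smul (β / 2))).congr fun j => ?_
      have h3 := hrec 0 j
      rw [zero_add] at h3
      rw [h3]; simp
    have hdiff := hyd.sub (hd 0 (by omega))
    -- The limit `y` and `v 0` have the same image under `∂ - β/2`, so their difference solves `z' =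
    -- (β/2) z`.
    have hz := ae_eq_zero_of_isWeakDeriv hγ (by positivity : 0 < β / 2) (hy.sub hv0)
      (hdiff.congr (EventuallyEq.refl _ _) (by
        refine Eventually.of_forall fun x => ?_
        simp; ring))
    have hyv : toL2 γ y = toL2 γ (v 0) := (toL2_eq_iff hy hv0).2 (by
      filter_upwards [hz] with x hx
      simpa [sub_eq_zero] using hx)
    -- The higher derivatives converge by the recursion `hrec`, starting from order `0`.
    refine ⟨p, fun k hk => ?_⟩
    induction k with
    | zero => rw [← hyv]; simpa using hL
    | succ k ihk =>
      have h1 := ihk (by omega)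
      have hvk := hv k (by omega)
      have h2 := (hq k (by omega)).add (h1.const_smul (β / 2))
      rw [← toL2_smul hvk, ← toL2_add ((hv _ hk).sub (hvk.smul _)) (hvk.smul _),
        sub_add_cancel] at h2
      refine h2.congr fun j => ?_
      rw [hrec k j, map_add, map_smul]

end Laguerre

/-! ### Hilbert space embedding, projections and passage to the limit. -/

namespace Laguerre

open Filter Topology Polynomial

/-- The Hilbert space in which the Sobolev space of order `n` is embedded. -/
abbrev SobSpace (n : ℕ) : Type := PiLp 2 fun _ : Fin (n + 1) => Lp ℝ 2 halfVol

/-- The coefficients of the form `a_n^{α,β}`. -/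
noncomputable def formCoeff (n : ℕ) (β : ℝ) (ν : ℕ) : ℝ :=
  (n.choose ν : ℝ) * ((β / 2) ^ 2) ^ (n - ν)

lemma formCoeff_nonneg (n : ℕ) (β : ℝ) (ν : ℕ) : 0 ≤ formCoeff n β ν := by
  unfold formCoeff; positivity

lemma formCoeff_pos {n ν : ℕ} {β : ℝ} (hβ : 0 < β) (h : ν ≤ n) : 0 < formCoeff n β ν := by
  have := Nat.choose_pos h
  unfold formCoeff; positivity

/-- The family of the weak derivatives, normalized so that `a_n^{α,β}` becomes the inner
product. -/
noncomputable def sobEmb (n : ℕ) (α β : ℝ) (u : ℝ → ℝ) : SobSpace n :=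
  WithLp.toLp 2 fun ν => Real.sqrt (formCoeff n β ν) • toL2 (α + n) (weakDeriv ν u)

section

variable {n r s : ℕ} {α β : ℝ} {u v : ℝ → ℝ}

lemma inner_sobEmb (hu : MemH n (powWeight (α + n)) u) (hv : MemH n (powWeight (α + n)) v) :
    inner ℝ (sobEmb n α β u) (sobEmb n α β v) = form n α β u v := by
  rw [PiLp.inner_apply, form, ← Fin.sum_univ_eq_sum_range (fun ν =>
    (n.choose ν : ℝ) * (β ^ (2 * n - 2 * ν) / 2 ^ (2 * n - 2 * ν)) *
      innerL2 (powWeight (α + n)) (weakDeriv ν u) (weakDeriv ν v))]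
  refine Finset.sum_congr rfl fun ν _ => ?_
  have hν : (ν : ℕ) ≤ n := Nat.lt_succ_iff.1 ν.2
  simp only [sobEmb]
  rw [real_inner_smul_left, real_inner_smul_right, inner_toL2 (hu.memL2 hν) (hv.memL2 hν),
    form_coeff, ← mul_assoc, Real.mul_self_sqrt (formCoeff_nonneg _ _ _), formCoeff]

lemma sobNorm_eq (hu : MemH n (powWeight (α + n)) u) : sobNorm n α β u = ‖sobEmb n α β u‖ := by
  rw [sobNorm, ← inner_sobEmb hu hu, real_inner_self_eq_norm_sq, Real.sqrt_sq (norm_nonneg _)]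

lemma sobEmb_sub (hu : MemH n (powWeight (α + n)) u) (hv : MemH n (powWeight (α + n)) v) :
    sobEmb n α β (u - v) = sobEmb n α β u - sobEmb n α β v := by
  ext1 ν
  have hν : (ν : ℕ) ≤ n := Nat.lt_succ_iff.1 ν.2
  simp only [sobEmb, PiLp.sub_apply]
  rw [← smul_sub, ← toL2_sub (hu.memL2 hν) (hv.memL2 hν),
    (toL2_eq_iff ((hu.sub hv).memL2 hν) ((hu.memL2 hν).sub (hv.memL2 hν))).2
      (hu.weakDeriv_sub hv hν)]

/-- The embedding `sobEmb` on the approximation spaces, as a linear map of the polynomial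
factor. -/
noncomputable def polyEmb (n : ℕ) (hβ : 0 < β) (hn : -1 < α + n) : ℝ[X] →ₗ[ℝ] SobSpace n where
  toFun p := WithLp.toLp 2 fun ν : Fin (n + 1) =>
    Real.sqrt (formCoeff n β ν) • expPolyL2 hβ hn ((expDeriv β ^ (ν : ℕ)) p)
  map_add' p q := by ext1 ν; simp [smul_add]
  map_smul' c p := by ext1 ν; simp [smul_comm c]

lemma polyEmb_apply (hβ : 0 < β) (hn : -1 < α + n) (p : ℝ[X]) (ν : Fin (n + 1)) :
    polyEmb n hβ hn p ν =
      Real.sqrt (formCoeff n β ν) • expPolyL2 hβ hn ((expDeriv β ^ (ν : ℕ)) p) := rfl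

lemma sobEmb_expPoly (hβ : 0 < β) (hn : -1 < α + n) (p : ℝ[X]) :
    sobEmb n α β (expPoly β p) = polyEmb n hβ hn p := by
  ext1 ν
  have hν : (ν : ℕ) ≤ n := Nat.lt_succ_iff.1 ν.2
  rw [polyEmb_apply, sobEmb]
  dsimp only
  congr 1
  exact (toL2_eq_iff ((memH_expPoly hβ hn n p).memL2 hν) (memL2_expPoly hβ hn _)).2
    (isWeakDeriv_expPoly β p ν).weakDeriv_ae

lemma inner_polyEmb (hβ : 0 < β) (hn : -1 < α + n) (p q : ℝ[X]) :
    inner ℝ (polyEmb n hβ hn p) (polyEmb n hβ hn q) = polyForm n α β p q := by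
  rw [← sobEmb_expPoly, ← sobEmb_expPoly,
    inner_sobEmb (memH_expPoly hβ hn n p) (memH_expPoly hβ hn n q), form_expPoly]

lemma norm_sq_polyEmb (hβ : 0 < β) (hn : -1 < α + n) (p : ℝ[X]) :
    ‖polyEmb n hβ hn p‖ ^ 2 = polyForm n α β p p := by
  rw [← real_inner_self_eq_norm_sq, inner_polyEmb]

lemma polyEmb_injective (hβ : 0 < β) (hn : -1 < α + n) :
    Function.Injective (polyEmb n hβ hn) := by
  rw [injective_iff_map_eq_zero]
  intro p hp
  by_contra hne
  have := polyForm_self_pos hβ hn hne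
  rw [← norm_sq_polyEmb hβ hn, hp] at this
  simp at this

/-- Makes sequences that converge in order `r` Cauchy in order `s`. The constant may depend on `β`,
since it serves convergence only. -/
lemma exists_norm_polyEmb_le (hβ : 0 < β) (hs : -1 < α + s) (hr : -1 < α + r) (hsr : s ≤ r) :
    ∃ C : ℝ, ∀ p, ‖polyEmb s hβ hs p‖ ≤ C * ‖polyEmb r hβ hr p‖ := by
  obtain ⟨d, hd, h⟩ := exists_polyForm_le_all α hβ hs hsr
  refine ⟨Real.sqrt d, fun p => (abs_le_of_sq_le_sq' ?_ (by positivity)).2⟩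
  rw [mul_pow, Real.sq_sqrt hd.le, norm_sq_polyEmb, norm_sq_polyEmb]
  exact h p

/-- The approximation spaces are dense in the Sobolev space. -/
lemma exists_tendsto_polyEmb (hβ : 0 < β) (hn : -1 < α + n)
    (hu : MemH n (powWeight (α + n)) u) : ∃ p : ℕ → ℝ[X],
      Tendsto (fun j => polyEmb n hβ hn (p j)) atTop (𝓝 (sobEmb n α β u)) := by
  obtain ⟨p, hp⟩ := exists_approx hβ hn n (fun k => weakDeriv k u) (fun k hk => hu.memL2 hk)
    (fun k hk => (hu.isWeakDeriv hk.le).of_succ (hu.isWeakDeriv hk))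
  refine ⟨p, (PiLp.continuous_toLp 2 _).tendsto _ |>.comp (tendsto_pi_nhds.2 fun ν => ?_)⟩
  exact (hp ν (Nat.lt_succ_iff.1 ν.2)).const_smul _

/-- The embedding of the weighted Sobolev space of order `r` in that of order `s ≤ r`. -/
lemma tendsto_polyEmb_of_le (hβ : 0 < β) (hs : -1 < α + s) (hr : -1 < α + r) (hsr : s ≤ r)
    (hu : MemH r (powWeight (α + r)) u) {p : ℕ → ℝ[X]}
    (hp : Tendsto (fun j => polyEmb r hβ hr (p j)) atTop (𝓝 (sobEmb r α β u))) :
    MemH s (powWeight (α + s)) u ∧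
      Tendsto (fun j => polyEmb s hβ hs (p j)) atTop (𝓝 (sobEmb s α β u)) := by
  have comp : ∀ {n : ℕ} (hn : -1 < α + n) {Z : SobSpace n},
      Tendsto (fun j => polyEmb n hβ hn (p j)) atTop (𝓝 Z) → ∀ ν : Fin (n + 1),
        Tendsto (fun j => expPolyL2 hβ hn ((expDeriv β ^ (ν : ℕ)) (p j))) atTop
          (𝓝 ((Real.sqrt (formCoeff n β ν))⁻¹ • Z ν)) := by
    intro n hn Z hZ ν
    have hc := (Real.sqrt_pos.2 (formCoeff_pos hβ (Nat.lt_succ_iff.1 ν.2))).ne'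
    have h1 := (tendsto_pi_nhds.1 ((PiLp.continuous_ofLp 2 _).tendsto _ |>.comp hZ) ν).const_smul
      (Real.sqrt (formCoeff n β ν))⁻¹
    refine h1.congr fun j => ?_
    change _ • polyEmb n hβ hn (p j) ν = _
    rw [polyEmb_apply, inv_smul_smul₀ hc]
  obtain ⟨C, hC⟩ := exists_norm_polyEmb_le hβ hs hr hsr
  obtain ⟨Z, hZ⟩ := cauchySeq_tendsto_of_complete
    (cauchySeq_of_dist_le (f := fun j => polyEmb s hβ hs (p j)) (C := C) (fun i j => by
      rw [dist_eq_norm, dist_eq_norm, ← map_sub, ← map_sub]; exact hC _) hp.cauchySeq)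
  have hu0 := hu.isWeakDeriv (Nat.zero_le r)
  have hu0' : weakDeriv 0 u =ᵐ[halfVol] u := (isWeakDeriv_zero hu0.1).weakDeriv_ae
  have hu0L := hu.memL2 (Nat.zero_le r)
  have h0 : Tendsto (fun j => toL2 (α + r) (expPoly β (p j))) atTop (𝓝 (toL2 (α + r) u)) := by
    have hc := (Real.sqrt_pos.2 (formCoeff_pos (n := r) hβ (Nat.zero_le r))).ne'
    have h1 := comp hr hp 0
    rw [show (sobEmb r α β u) 0 = Real.sqrt (formCoeff r β 0) • toL2 (α + r) (weakDeriv 0 u)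
      from rfl] at h1
    simp only [Fin.val_zero] at h1
    rw [inv_smul_smul₀ hc, (toL2_eq_iff hu0L (hu0L.congr hu0')).2 hu0'] at h1
    exact h1
  -- The functions converge in the weight of order `r`, their derivatives in that of order `s`;
  -- closedness of weak differentiation across two weights identifies the components of `Z`.
  have key : ∀ ν : Fin (s + 1), ∃ y, MemL2 (powWeight (α + s)) y ∧ IsWeakDeriv ν u y ∧
      Z ν = Real.sqrt (formCoeff s β ν) • toL2 (α + s) y := by
    intro ν
    have hc := (Real.sqrt_pos.2 (formCoeff_pos hβ (Nat.lt_succ_iff.1 ν.2))).ne'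
    obtain ⟨y, hy, hyZ⟩ := exists_toL2_eq (α + s) ((Real.sqrt (formCoeff s β ν))⁻¹ • Z ν)
    refine ⟨y, hy, ?_, by rw [hyZ, smul_inv_smul₀ hc]⟩
    refine isWeakDeriv_of_tendsto (fun j => memL2_expPoly hβ hr (p j)) (hu0L.congr hu0')
      (fun j => memL2_expPoly hβ hs ((expDeriv β ^ (ν : ℕ)) (p j))) hy
      (fun j => isWeakDeriv_expPoly β (p j) ν) h0 ?_
    rw [hyZ]
    exact comp hs hZ ν
  have hus : MemH s (powWeight (α + s)) u := fun k hk => by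
    obtain ⟨y, hy, hyu, -⟩ := key ⟨k, Nat.lt_succ_iff.2 hk⟩
    exact ⟨y, hyu, hy⟩
  refine ⟨hus, ?_⟩
  have hZu : Z = sobEmb s α β u := by
    ext1 ν
    obtain ⟨y, hy, hyu, hyZ⟩ := key ν
    rw [hyZ, sobEmb]
    dsimp only
    congr 1
    exact (toL2_eq_iff hy (hus.memL2 (Nat.lt_succ_iff.1 ν.2))).2 hyu.weakDeriv_ae.symm
  rwa [← hZu]

/-- Membership does not involve `β`, so the approximation may be run with `β = 1`. -/
lemma memH_of_le (hs : -1 < α + s) (hr : -1 < α + r) (hsr : s ≤ r)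
    (hu : MemH r (powWeight (α + r)) u) : MemH s (powWeight (α + s)) u := by
  obtain ⟨p, hp⟩ := exists_tendsto_polyEmb one_pos hr hu
  exact (tendsto_polyEmb_of_le one_pos hs hr hsr hu hp).1

/-- The image of the approximation space of degree `N`. -/
noncomputable def approxSpace (n N : ℕ) (hβ : 0 < β) (hn : -1 < α + n) :
    Submodule ℝ (SobSpace n) :=
  (degreeLT ℝ (N + 1)).map (polyEmb n hβ hn)

lemma mem_degreeLT_iff {N : ℕ} {q : ℝ[X]} : q ∈ degreeLT ℝ (N + 1) ↔ q.natDegree ≤ N := by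
  rw [mem_degreeLT, natDegree_le_iff_degree_le]
  rcases eq_or_ne q 0 with rfl | hq
  · simp
  · rw [degree_eq_natDegree hq]; norm_cast; exact Nat.lt_succ_iff

instance (n N : ℕ) (hβ : 0 < β) (hn : -1 < α + n) :
    FiniteDimensional ℝ (approxSpace n N hβ hn) := by
  have : FiniteDimensional ℝ (degreeLT ℝ (N + 1)) :=
    Module.Finite.equiv (degreeLTEquiv ℝ (N + 1)).symm
  unfold approxSpace; infer_instance

/-- Reduces existence, uniqueness and continuity of the projection to those of the Hilbert space
projection onto a finite-dimensional subspace. -/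
lemma isProj_expPoly_iff (hβ : 0 < β) (hn : -1 < α + n) {N : ℕ}
    (hu : MemH n (powWeight (α + n)) u) (q : ℝ[X]) : IsProj n N α β u (expPoly β q) ↔
      q.natDegree ≤ N ∧
        polyEmb n hβ hn q = (approxSpace n N hβ hn).starProjection (sobEmb n α β u) := by
  have hX : expPoly β q ∈ X N β ↔ q.natDegree ≤ N := by
    constructor
    · rintro ⟨p, hp, h⟩
      rwa [expPoly_injective β (h : expPoly β q = expPoly β p)]
    · exact fun h => ⟨q, h, rfl⟩
  rw [IsProj, hX]
  refine and_congr_right fun hq => ?_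
  have hqW : polyEmb n hβ hn q ∈ approxSpace n N hβ hn := ⟨q, mem_degreeLT_iff.2 hq, rfl⟩
  have hform : ∀ v, form n α β (u - expPoly β q) (expPoly β v) =
      inner ℝ (sobEmb n α β u - polyEmb n hβ hn q) (polyEmb n hβ hn v) := by
    intro v
    have hq' := memH_expPoly hβ hn n q
    rw [← inner_sobEmb (hu.sub hq') (memH_expPoly hβ hn n v), sobEmb_sub hu hq',
      sobEmb_expPoly hβ hn, sobEmb_expPoly hβ hn]
  constructor
  · intro h
    refine (Submodule.eq_starProjection_of_mem_of_inner_eq_zero hqW ?_).symm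
    rintro _ ⟨v, hv, rfl⟩
    rw [← hform]
    exact h _ ⟨v, mem_degreeLT_iff.1 hv, rfl⟩
  · rintro h _ ⟨v, hv, rfl⟩
    change form n α β (u - expPoly β q) (expPoly β v) = 0
    rw [hform, h]
    exact Submodule.starProjection_inner_eq_zero _ _ ⟨v, mem_degreeLT_iff.2 hv, rfl⟩

lemma exists_isProj (hβ : 0 < β) (hn : -1 < α + n) (N : ℕ)
    (hu : MemH n (powWeight (α + n)) u) : ∃ q : ℝ[X], IsProj n N α β u (expPoly β q) := by
  obtain ⟨q, hq, hqe⟩ := (approxSpace n N hβ hn).starProjection_apply_mem (sobEmb n α β u)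
  exact ⟨q, (isProj_expPoly_iff hβ hn hu q).2 ⟨mem_degreeLT_iff.1 hq, hqe⟩⟩

lemma IsProj.unique (hβ : 0 < β) (hn : -1 < α + n) {N : ℕ}
    (hu : MemH n (powWeight (α + n)) u) {f g : ℝ → ℝ} (hf : IsProj n N α β u f)
    (hg : IsProj n N α β u g) : f = g := by
  obtain ⟨p, -, rfl⟩ := hf.1
  obtain ⟨q, -, rfl⟩ := hg.1
  have h1 := ((isProj_expPoly_iff hβ hn hu p).1 hf).2
  have h2 := ((isProj_expPoly_iff hβ hn hu q).1 hg).2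
  rw [polyEmb_injective hβ hn (h1.trans h2.symm)]

lemma exists_proj_eq (hβ : 0 < β) (hn : -1 < α + n) (N : ℕ)
    (hu : MemH n (powWeight (α + n)) u) : ∃ q : ℝ[X], proj n N α β u = expPoly β q ∧
      IsProj n N α β u (expPoly β q) := by
  obtain ⟨q, hq⟩ := exists_isProj hβ hn N hu
  have hex : ∃ f, IsProj n N α β u f := ⟨_, hq⟩
  refine ⟨q, ?_, hq⟩
  rw [proj, dif_pos hex]
  exact hex.choose_spec.unique hβ hn hu hq

/-- The projections of an approximating sequence: they are orthogonal with respect to all the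
forms, and converge to the projection of the limit. -/
lemma exists_tendsto_proj (hβ : 0 < β) (hs : -1 < α + s) (hr : -1 < α + r) (hsr : s ≤ r) (N : ℕ)
    (hu : MemH r (powWeight (α + r)) u) : ∃ (q : ℝ[X]) (e : ℕ → ℝ[X]),
      proj r N α β u = expPoly β q ∧ proj s N α β u = expPoly β q ∧
      (∀ j, ∀ v : ℝ[X], v.natDegree ≤ N → polyForm r α β (e j) v = 0) ∧
      Tendsto (fun j => polyEmb r hβ hr (e j)) atTop (𝓝 (sobEmb r α β (u - expPoly β q))) ∧
      Tendsto (fun j => polyEmb s hβ hs (e j)) atTop (𝓝 (sobEmb s α β (u - expPoly β q))) := by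
  obtain ⟨p, hp⟩ := exists_tendsto_polyEmb hβ hr hu
  obtain ⟨hus, hps⟩ := tendsto_polyEmb_of_le hβ hs hr hsr hu hp
  choose w hw using fun j => exists_isProj hβ hr N (memH_expPoly hβ hr r (p j))
  have hort : ∀ j, ∀ v : ℝ[X], v.natDegree ≤ N → polyForm r α β (p j - w j) v = 0 := by
    intro j v hv
    rw [← form_expPoly, expPoly_sub]
    exact (hw j).2 _ ⟨v, hv, rfl⟩
  have hdeg : ∀ j, (w j).natDegree ≤ N := fun j =>
    ((isProj_expPoly_iff hβ hr (memH_expPoly hβ hr r (p j)) _).1 (hw j)).1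
  -- Here the independence of the order enters: the projection of order `r` of an approximant is
  -- also its projection of order `s`.
  have hws : ∀ j, IsProj s N α β (expPoly β (p j)) (expPoly β (w j)) := by
    intro j
    refine ⟨⟨_, hdeg j, rfl⟩, ?_⟩
    rintro _ ⟨v, hv, rfl⟩
    change form s α β _ (expPoly β v) = 0
    rw [← expPoly_sub, form_expPoly]
    exact orthogonal_of_orthogonal hβ hr hs (hort j) hv
  have conv : ∀ {n : ℕ} (hn : -1 < α + n), MemH n (powWeight (α + n)) u →
      (∀ j, IsProj n N α β (expPoly β (p j)) (expPoly β (w j))) →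
      Tendsto (fun j => polyEmb n hβ hn (p j)) atTop (𝓝 (sobEmb n α β u)) →
      ∀ {q : ℝ[X]}, IsProj n N α β u (expPoly β q) →
        Tendsto (fun j => polyEmb n hβ hn (w j)) atTop (𝓝 (polyEmb n hβ hn q)) := by
    intro n hn hun hwn hpn q hq
    rw [((isProj_expPoly_iff hβ hn hun q).1 hq).2]
    refine (((approxSpace n N hβ hn).starProjection.continuous.tendsto _).comp hpn).congr
      fun j => ?_
    rw [((isProj_expPoly_iff hβ hn (memH_expPoly hβ hn n (p j)) _).1 (hwn j)).2,
      sobEmb_expPoly hβ hn]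
    rfl
  obtain ⟨q, hq, hqp⟩ := exists_proj_eq hβ hr N hu
  obtain ⟨q', hq', hqp'⟩ := exists_proj_eq hβ hs N hus
  have c1 := conv hr hu hw hp hqp
  have c2 := conv hs hus hws hps hqp'
  -- The common projections `w j` converge to `q` in order `r`, hence in order `s`, where their
  -- limit is `q'`.
  have c3 : Tendsto (fun j => polyEmb s hβ hs (w j)) atTop (𝓝 (polyEmb s hβ hs q)) := by
    obtain ⟨C, hC⟩ := exists_norm_polyEmb_le hβ hs hr hsr
    rw [tendsto_iff_norm_sub_tendsto_zero] at c1 ⊢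
    refine squeeze_zero (fun _ => norm_nonneg _) (fun j => ?_) (by simpa using c1.const_mul C)
    rw [← map_sub, ← map_sub]; exact hC _
  have hqq : q = q' := polyEmb_injective hβ hs (tendsto_nhds_unique c3 c2)
  have lim : ∀ {n : ℕ} (hn : -1 < α + n), MemH n (powWeight (α + n)) u →
      Tendsto (fun j => polyEmb n hβ hn (p j)) atTop (𝓝 (sobEmb n α β u)) →
      Tendsto (fun j => polyEmb n hβ hn (w j)) atTop (𝓝 (polyEmb n hβ hn q)) →
      Tendsto (fun j => polyEmb n hβ hn (p j - w j)) atTop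
        (𝓝 (sobEmb n α β (u - expPoly β q))) := by
    intro n hn hun h1 h2
    rw [sobEmb_sub hun (memH_expPoly hβ hn n q), sobEmb_expPoly hβ hn]
    refine (h1.sub h2).congr fun j => ?_
    rw [map_sub]
  exact ⟨q, fun j => p j - w j, hq, by rw [hq', hqq], hort, lim hr hu hp c1, lim hs hus hps c3⟩

lemma proj_eq_of_le (hβ : 0 < β) (hs : -1 < α + s) (hr : -1 < α + r) (hsr : s ≤ r) (N : ℕ)
    (hu : MemH r (powWeight (α + r)) u) : proj s N α β u = proj r N α β u := by
  obtain ⟨q, e, h1, h2, -⟩ := exists_tendsto_proj hβ hs hr hsr N hu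
  rw [h1, h2]

/-- Pythagoras for the orthogonal projection in `SobSpace r`. -/
lemma sobNorm_sub_proj_le (hβ : 0 < β) (hr : -1 < α + r) (N : ℕ)
    (hu : MemH r (powWeight (α + r)) u) :
    sobNorm r α β (u - proj r N α β u) ≤ sobNorm r α β u := by
  obtain ⟨q, hq, hqp⟩ := exists_proj_eq hβ hr N hu
  have hqm := memH_expPoly hβ hr r q
  rw [hq, sobNorm_eq (hu.sub hqm), sobNorm_eq hu, sobEmb_sub hu hqm, sobEmb_expPoly hβ hr,
    ((isProj_expPoly_iff hβ hr hu q).1 hqp).2]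
  have h := Submodule.norm_sq_eq_add_norm_sq_starProjection (sobEmb r α β u)
    (approxSpace r N hβ hr)
  rw [Submodule.starProjection_orthogonal_val] at h
  refine (abs_le_of_sq_le_sq' ?_ (norm_nonneg _)).2
  nlinarith [sq_nonneg ‖(approxSpace r N hβ hr).starProjection (sobEmb r α β u)‖]

end

/-- The error estimate in the norms of lower order. -/
lemma exists_sobNorm_sub_proj_le (α : ℝ) {s r : ℕ} (hs : -1 < α + s) (hsr : s ≤ r) :
    ∃ c : ℝ, 0 < c ∧ ∀ β : ℝ, 0 < β → ∀ u, MemH r (powWeight (α + r)) u →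
      ∀ N : ℕ, 0 < N → sobNorm s α β (u - proj r N α β u) ≤
        c * ((β * N) ^ (((s : ℝ) - r) / 2) * sobNorm r α β (u - proj r N α β u)) := by
  have hr : -1 < α + r := by
    have : (s : ℝ) ≤ r := by exact_mod_cast hsr
    linarith
  obtain ⟨d, hd, h⟩ := exists_polyForm_le α hs hsr
  refine ⟨(Real.sqrt d)⁻¹, by positivity, fun β hβ u hu N hN => ?_⟩
  obtain ⟨q, e, h1, -, hort, hlr, hls⟩ := exists_tendsto_proj hβ hs hr hsr N hu
  have hus := memH_of_le hs hr hsr hu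
  rw [h1, sobNorm_eq (hu.sub (memH_expPoly hβ hr r q)),
    sobNorm_eq (hus.sub (memH_expPoly hβ hs s q))]
  have hN' : (0 : ℝ) < N := by exact_mod_cast hN
  have hb : 0 < β * N := by positivity
  -- The polynomial estimate holds along the errors `e j`, which are orthogonal to the approximation
  -- space, and survives the limit. Taking roots produces the constant `d^{-1/2}`.
  have hlim : d * (β * N) ^ (r - s) * ‖sobEmb s α β (u - expPoly β q)‖ ^ 2 ≤
      ‖sobEmb r α β (u - expPoly β q)‖ ^ 2 := by
    refine le_of_tendsto_of_tendsto' ((hls.norm.pow 2).const_mul _) (hlr.norm.pow 2) fun j => ?_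
    rw [norm_sq_polyEmb, norm_sq_polyEmb]
    exact h β hβ N hN (e j) (hort j)
  have hpow : ((β * N) ^ (((s : ℝ) - r) / 2)) ^ 2 * (β * N) ^ (r - s) = 1 := by
    rw [← Real.rpow_natCast ((β * N) ^ _), ← Real.rpow_mul hb.le, ← Real.rpow_natCast (β * N),
      ← Real.rpow_add hb, Nat.cast_sub hsr]
    rw [show ((s : ℝ) - r) / 2 * ((2 : ℕ) : ℝ) + ((r : ℝ) - s) = 0 by push_cast; ring,
      Real.rpow_zero]
  refine (abs_le_of_sq_le_sq' ?_ (by positivity)).2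
  set t := (β * N) ^ (((s : ℝ) - r) / 2)
  rw [mul_pow, mul_pow, inv_pow, Real.sq_sqrt hd.le]
  calc _ = d⁻¹ * (t ^ 2 * (d * (β * N) ^ (r - s) *
        ‖sobEmb s α β (u - expPoly β q)‖ ^ 2)) := by
        field_simp
        linear_combination (-‖sobEmb s α β (u - expPoly β q)‖ ^ 2) * hpow
    _ ≤ _ := by gcongr

end Laguerre

/-! ### The theorem. -/

theorem theorem4p1 (r : ℕ) (α : ℝ) (hα : -(r : ℝ) - 1 < α) :
    -- the projection is well defined and does not depend on the order that defines it
    (∀ β : ℝ, 0 < β → ∀ (N : ℕ) (u : ℝ → ℝ), Laguerre.MemH r (Laguerre.powWeight (α + r)) u →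
      (∃! p : ℝ → ℝ, Laguerre.IsProj r N α β u p) ∧
      (∀ s : ℕ, -α - 1 < s → s ≤ r → Laguerre.MemH s (Laguerre.powWeight (α + s)) u) ∧
      (∀ s : ℕ, -α - 1 < N → -α - 1 < s → Laguerre.MemH s (Laguerre.powWeight (α + s)) u →
        Laguerre.proj s N α β u = Laguerre.proj r N α β u)) ∧
    -- the error estimate, with a constant that depends on `α` and `r` only
    (∃ c : ℝ, 0 < c ∧ ∀ β : ℝ, 0 < β → ∀ u : ℝ → ℝ,
      Laguerre.MemH r (Laguerre.powWeight (α + r)) u →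
      ∀ N s : ℕ, -α - 1 < N → -α - 1 < s → s ≤ r → (0 < N ∨ s = r) →
        Laguerre.sobNorm s α β (u - Laguerre.proj r N α β u) ≤
            c * ((β * N) ^ (((s : ℝ) - r) / 2) *
              Laguerre.sobNorm r α β (u - Laguerre.proj r N α β u)) ∧
        (β * N) ^ (((s : ℝ) - r) / 2) *
              Laguerre.sobNorm r α β (u - Laguerre.proj r N α β u) ≤
            c * ((β * N) ^ (((s : ℝ) - r) / 2) * Laguerre.sobNorm r α β u)) := by
  have hr : -1 < α + r := by linarith
  constructor
  · intro β hβ N u hu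
    refine ⟨?_, fun s hs hsr => Laguerre.memH_of_le (by linarith) hr hsr hu, fun s _ hs hus => ?_⟩
    · obtain ⟨q, hq⟩ := Laguerre.exists_isProj hβ hr N hu
      exact ⟨_, hq, fun f hf => hf.unique hβ hr hu hq⟩
    -- For `s > r` the roles are exchanged, `u` being in the space of the higher order `s` by
    -- assumption.
    · rcases le_total s r with h | h
      · exact Laguerre.proj_eq_of_le hβ (by linarith) hr h N hu
      · exact (Laguerre.proj_eq_of_le hβ hr (by linarith) h N hus).symm
  · have hex : ∀ s : ℕ, ∃ c : ℝ, 0 < c ∧ (-1 < α + s → s ≤ r → ∀ β : ℝ, 0 < β → ∀ u,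
        Laguerre.MemH r (Laguerre.powWeight (α + r)) u → ∀ N : ℕ, 0 < N →
          Laguerre.sobNorm s α β (u - Laguerre.proj r N α β u) ≤
            c * ((β * N) ^ (((s : ℝ) - r) / 2) *
              Laguerre.sobNorm r α β (u - Laguerre.proj r N α β u))) := by
      intro s
      by_cases h : -1 < α + s ∧ s ≤ r
      · obtain ⟨c, hc, hcs⟩ := Laguerre.exists_sobNorm_sub_proj_le α h.1 h.2
        exact ⟨c, hc, fun _ _ => hcs⟩
      · exact ⟨1, one_pos, fun h1 h2 => absurd ⟨h1, h2⟩ h⟩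
    choose c hc hcs using hex
    have hsum : 0 ≤ ∑ s ∈ Finset.range (r + 1), c s := Finset.sum_nonneg fun s _ => (hc s).le
    -- The sum makes the constant uniform in `s ≤ r`; the summand `1` serves the case `s = r` and
    -- the second inequality.
    refine ⟨1 + ∑ s ∈ Finset.range (r + 1), c s, by linarith, ?_⟩
    intro β hβ u hu N s hN hs hsr hor
    have hpow : (0 : ℝ) ≤ (β * N) ^ (((s : ℝ) - r) / 2) := by positivity
    have hn0 : ∀ f, 0 ≤ Laguerre.sobNorm r α β f := fun f => Real.sqrt_nonneg _
    constructor
    · rcases hor with hN0 | rfl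
      · refine (hcs s (by linarith) hsr β hβ u hu N hN0).trans
          (mul_le_mul_of_nonneg_right ?_ (mul_nonneg hpow (hn0 _)))
        have := Finset.single_le_sum (f := c) (fun s _ => (hc s).le)
          (Finset.mem_range.2 (Nat.lt_succ_iff.2 hsr))
        linarith
      -- With `s = r` the exponent is `0`, and `0 ^ 0 = 1` covers `N = 0`.
      · rw [sub_self, zero_div, Real.rpow_zero, one_mul]
        exact le_mul_of_one_le_left (hn0 _) (by linarith)
    · have h1 := mul_le_mul_of_nonneg_left (Laguerre.sobNorm_sub_proj_le hβ hr N hu) hpow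
      exact h1.trans (le_mul_of_one_le_left (mul_nonneg hpow (hn0 _)) (by linarith))
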